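/- Let $\Omega\subset\mathbb{R}^2$ be a bounded Lipschitz domain. For a Biot number $B\ge 0$, let $\psi(B)\in H^1(\Omega)$ be the first eigenfunction of the Robin Laplacian (the case $\sigma=\kappa=1$): the nonnegative function with $\int_\Omega \psi(B)^2=1$ such that $$\int_\Omega \nabla\psi(B)\cdot\nabla v + B\int_{\partial\Omega}\psi(B)\,v=\lambda(B)\int_\Omega\psi(B)\,v\qquad\text{for all } v\in H^1(\Omega),$$ where $\lambda(B)$ is the smallest eigenvalue of this problem. Let $\psi'^{\,0}=\frac{d\psi}{dB}\big|_{B=0}\in H^1(\Omega)$ be the (right) derivative at $B=0$, and put $$\phi(\Omega)=\int_\Omega|\nabla\psi'^{\,0}|^2 .$$ For $W>0$ let $T_W$ be the open right triangle with vertices $(0,0)$, $(W,0)$, $(0,1)$. Then $\psi(B)$ is uniquely determined for all small $B\ge0$, and $\psi'^{\,0}$ exists, when $\Omega=T_W$ for any $W>0$ and when $\Omega$ is any equilateral triangle; moreover: 1. $\phi(T_W)\sim\frac23 W^{-2}$ as $W\to0^+$; 2. $\phi(T_1)=\frac43$; 3. $\phi(\Omega)=1$ for every equilateral triangle $\Omega$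 (of any size and position). -/

import Mathlib

open Set Filter Topology MeasureTheory Asymptotics
open scoped ContDiff Gradient

noncomputable section

namespace Dunking

/-- The Euclidean plane. -/
abbrev Plane : Type := EuclideanSpace ℝ (Fin 2)

/-- Area measure on the domain `Ω`. -/
abbrev interiorMeasure (Ω : Set Plane) : Measure Plane := volume.restrict Ω

/-- Arc length (one-dimensional Hausdorff measure) on the boundary of `Ω`. -/
abbrev boundaryMeasure (Ω : Set Plane) : Measure Plane :=
  (Measure.hausdorffMeasure 1 : Measure Plane).restrict (frontier Ω)

/-! ### The Sobolev space `H¹(Ω)` and boundary traces -/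

/-- Triples `(u, g, t)` of a function and a vector field in `L²(Ω)` and a function in `L²(∂Ω)`,
with the Hilbert norm `(‖u‖² + ‖g‖² + ‖t‖²)^(1/2)`. -/
abbrev Triple (Ω : Set Plane) : Type :=
  WithLp 2 (Lp ℝ 2 (interiorMeasure Ω) ×
    WithLp 2 (Lp Plane 2 (interiorMeasure Ω) × Lp ℝ 2 (boundaryMeasure Ω)))

/-- `g` is the weak gradient of `u` in `Ω`: integration by parts against `C_c^∞(Ω)`. -/
def HasWeakGradient (Ω : Set Plane) (u : Plane → ℝ) (g : Plane → Plane) : Prop :=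
  ∀ η : Plane → ℝ, ContDiff ℝ ∞ η → HasCompactSupport η → tsupport η ⊆ Ω →
    ∫ x in Ω, u x • ∇ η x = - ∫ x in Ω, η x • g x

lemma integrable_smul_gradient {Ω : Set Plane} (u : Lp ℝ 2 (interiorMeasure Ω)) {η : Plane → ℝ}
    (hη : ContDiff ℝ ∞ η) (hc : HasCompactSupport η) :
    Integrable (fun x => u x • ∇ η x) (interiorMeasure Ω) := by
  have hcont : Continuous (∇ η) := by
    unfold gradient
    exact (LinearIsometryEquiv.continuous _).comp (hη.continuous_fderiv (by simp))
  have hcs : HasCompactSupport (∇ η) := by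
    have := hc.fderiv (𝕜 := ℝ)
    exact this.comp_left (g := (InnerProductSpace.toDual ℝ Plane).symm) (map_zero _)
  have h1 : MemLp (∇ η) 2 (interiorMeasure Ω) :=
    (hcont.memLp_of_hasCompactSupport hcs (μ := volume)).restrict Ω
  exact memLp_one_iff_integrable.1 (h1.smul (Lp.memLp u))

lemma integrable_smul_vector {Ω : Set Plane} (g : Lp Plane 2 (interiorMeasure Ω)) {η : Plane → ℝ}
    (hη : ContDiff ℝ ∞ η) (hc : HasCompactSupport η) :
    Integrable (fun x => η x • g x) (interiorMeasure Ω) := by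
  have h1 : MemLp η 2 (interiorMeasure Ω) :=
    (hη.continuous.memLp_of_hasCompactSupport hc (μ := volume)).restrict Ω
  exact memLp_one_iff_integrable.1 ((Lp.memLp g).smul h1)

/-- The triples `(u, g, t)` for which `g` is the weak gradient of `u`. -/
def weakGradientGraph (Ω : Set Plane) : Submodule ℝ (Triple Ω) where
  carrier := {w | HasWeakGradient Ω w.fst w.snd.fst}
  zero_mem' := by
    intro η _ _ _
    have h1 : (fun x => ((0 : Triple Ω).fst : Plane → ℝ) x • ∇ η x) =ᵐ[interiorMeasure Ω] 0 := by
      filter_upwards [Lp.coeFn_zero ℝ 2 (interiorMeasure Ω)] with x hx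
      rw [WithLp.zero_fst, hx]
      simp
    have h2 : (fun x => η x • ((0 : Triple Ω).snd.fst : Plane → Plane) x)
        =ᵐ[interiorMeasure Ω] 0 := by
      filter_upwards [Lp.coeFn_zero Plane 2 (interiorMeasure Ω)] with x hx
      rw [WithLp.zero_snd, WithLp.zero_fst, hx]
      simp
    rw [integral_congr_ae h1, integral_congr_ae h2]
    simp
  add_mem' := by
    intro a b ha hb η hη hc hs
    have h1 : (fun x => ((a + b).fst : Plane → ℝ) x • ∇ η x) =ᵐ[interiorMeasure Ω]
        fun x => a.fst x • ∇ η x + b.fst x • ∇ η x := by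
      filter_upwards [Lp.coeFn_add a.fst b.fst] with x hx
      rw [WithLp.add_fst, hx, Pi.add_apply, add_smul]
    have h2 : (fun x => η x • ((a + b).snd.fst : Plane → Plane) x) =ᵐ[interiorMeasure Ω]
        fun x => η x • a.snd.fst x + η x • b.snd.fst x := by
      filter_upwards [Lp.coeFn_add a.snd.fst b.snd.fst] with x hx
      rw [WithLp.add_snd, WithLp.add_fst, hx, Pi.add_apply, smul_add]
    rw [integral_congr_ae h1, integral_congr_ae h2,
      integral_add (integrable_smul_gradient _ hη hc) (integrable_smul_gradient _ hη hc),
      integral_add (integrable_smul_vector _ hη hc) (integrable_smul_vector _ hη hc),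
      ha η hη hc hs, hb η hη hc hs, neg_add]
  smul_mem' := by
    intro c a ha η hη hc hs
    have h1 : (fun x => ((c • a).fst : Plane → ℝ) x • ∇ η x) =ᵐ[interiorMeasure Ω]
        fun x => c • (a.fst x • ∇ η x) := by
      filter_upwards [Lp.coeFn_smul c a.fst] with x hx
      simp [hx, mul_smul]
    have h2 : (fun x => η x • ((c • a).snd.fst : Plane → Plane) x) =ᵐ[interiorMeasure Ω]
        fun x => c • (η x • a.snd.fst x) := by
      filter_upwards [Lp.coeFn_smul c a.snd.fst] with x hx
      simp [hx, smul_comm (η x) c]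
    rw [integral_congr_ae h1, integral_congr_ae h2, integral_smul, integral_smul,
      ha η hη hc hs, smul_neg]

/-- The triples `(f|_Ω, ∇f|_Ω, f|_∂Ω)` with `f` smooth on the plane. -/
def smoothGraph (Ω : Set Plane) : Submodule ℝ (Triple Ω) where
  carrier := {w | ∃ f : Plane → ℝ, ContDiff ℝ ∞ f ∧ w.fst =ᵐ[interiorMeasure Ω] f ∧
    w.snd.fst =ᵐ[interiorMeasure Ω] ∇ f ∧ w.snd.snd =ᵐ[boundaryMeasure Ω] f}
  zero_mem' := by
    refine ⟨0, contDiff_const, Lp.coeFn_zero _ _ _, ?_, Lp.coeFn_zero _ _ _⟩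
    have h : ∇ (0 : Plane → ℝ) = 0 := by
      funext x
      exact gradient_fun_const x (0 : ℝ)
    rw [h]
    exact Lp.coeFn_zero _ _ _
  add_mem' := by
    rintro a b ⟨f, hf, hf1, hf2, hf3⟩ ⟨k, hk, hk1, hk2, hk3⟩
    refine ⟨f + k, hf.add hk, ?_, ?_, ?_⟩
    · filter_upwards [Lp.coeFn_add a.fst b.fst, hf1, hk1] with x hx h1 h2
      rw [WithLp.add_fst, hx, Pi.add_apply, Pi.add_apply, h1, h2]
    · filter_upwards [Lp.coeFn_add a.snd.fst b.snd.fst, hf2, hk2] with x hx h1 h2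
      have hd : ∇ (f + k) x = ∇ f x + ∇ k x := by
        unfold gradient
        rw [fderiv_add (hf.differentiable (by simp) x) (hk.differentiable (by simp) x), map_add]
      rw [WithLp.add_snd, WithLp.add_fst, hx, Pi.add_apply, h1, h2, hd]
    · filter_upwards [Lp.coeFn_add a.snd.snd b.snd.snd, hf3, hk3] with x hx h1 h2
      rw [WithLp.add_snd, WithLp.add_snd, hx, Pi.add_apply, Pi.add_apply, h1, h2]
  smul_mem' := by
    rintro c a ⟨f, hf, hf1, hf2, hf3⟩
    refine ⟨c • f, hf.const_smul c, ?_, ?_, ?_⟩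
    · filter_upwards [Lp.coeFn_smul c a.fst, hf1] with x hx h1
      simp [hx, h1]
    · filter_upwards [Lp.coeFn_smul c a.snd.fst, hf2] with x hx h1
      have hd : ∇ (c • f) x = c • ∇ f x := by
        unfold gradient
        rw [fderiv_const_smul (hf.differentiable (by simp) x)]
        simp
      simp [hx, h1, hd]
    · filter_upwards [Lp.coeFn_smul c a.snd.snd, hf3] with x hx h1
      simp [hx, h1]

/-- The space `H¹(Ω)`, each element listed with its weak gradient and its trace: triples
`(u, g, t)` such that `g ∈ L²(Ω)` is the weak gradient of `u ∈ L²(Ω)`, and `t ∈ L²(∂Ω)` is the trace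
of `u`, that is, the limit in `L²(∂Ω)` of the boundary values of smooth functions that converge to
`u` in `H¹(Ω)`. On a bounded Lipschitz domain every `u ∈ H¹(Ω)` has exactly one weak gradient and
exactly one trace, and the norm of the triple is equivalent to the norm of `u` in `H¹(Ω)`. -/
def H1 (Ω : Set Plane) : Submodule ℝ (Triple Ω) :=
  weakGradientGraph Ω ⊓ (smoothGraph Ω).topologicalClosure

/-- The underlying function in `L²(Ω)`. -/
def val {Ω : Set Plane} (w : H1 Ω) : Lp ℝ 2 (interiorMeasure Ω) := w.1.fst

/-- The weak gradient. -/
def grad {Ω : Set Plane} (w : H1 Ω) : Lp Plane 2 (interiorMeasure Ω) := w.1.snd.fst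

/-- The boundary trace. -/
def trace {Ω : Set Plane} (w : H1 Ω) : Lp ℝ 2 (boundaryMeasure Ω) := w.1.snd.snd

/-! ### Bilinear forms and the Robin eigenproblem -/

/-- `m(w, v; σ) = ∫_Ω σ w v`. -/
def formM (σ : Plane → ℝ) {Ω : Set Plane} (w v : H1 Ω) : ℝ :=
  ∫ x in Ω, σ x * val w x * val v x

/-- `a₀(w, v; κ) = ∫_Ω κ ∇w · ∇v`. -/
def formA0 (κ : Plane → ℝ) {Ω : Set Plane} (w v : H1 Ω) : ℝ :=
  ∫ x in Ω, κ x * inner ℝ (grad w x) (grad v x)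

/-- `a₁(w, v) = ∫_∂Ω w v`. -/
def formA1 {Ω : Set Plane} (w v : H1 Ω) : ℝ :=
  ∫ x, trace w x * trace v x ∂(boundaryMeasure Ω)

/-- `(ψ, l)` is a weak eigenpair, for the Biot number `B`, of `-∇·(κ∇ψ) = l σ ψ` in `Ω` with the
Robin condition `κ ∂ₙψ + B ψ = 0` on `∂Ω`, normalized by `∫_Ω σ ψ² = 1`. -/
def IsRobinEigenpair (σ κ : Plane → ℝ) (Ω : Set Plane) (B : ℝ) (ψ : H1 Ω) (l : ℝ) : Prop :=
  (∀ v : H1 Ω, formA0 κ ψ v + B * formA1 ψ v = l * formM σ ψ v) ∧ formM σ ψ ψ = 1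

/-- `ψ` is the first eigenfunction for `B`: a normalized eigenfunction for the least eigenvalue,
with its sign fixed by taking it nonnegative. -/
def IsFirstEigenfunction (σ κ : Plane → ℝ) (Ω : Set Plane) (B : ℝ) (ψ : H1 Ω) : Prop :=
  (∃ l : ℝ, IsRobinEigenpair σ κ Ω B ψ l ∧
    ∀ (χ : H1 Ω) (l' : ℝ), IsRobinEigenpair σ κ Ω B χ l' → l ≤ l') ∧
  ∀ᵐ x ∂(interiorMeasure Ω), 0 ≤ val ψ x

open Classical in
/-- The first eigenfunction `ψ₁(B)` (with the junk value `0` if there is not exactly one). -/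
def firstEigenfunction (σ κ : Plane → ℝ) (Ω : Set Plane) (B : ℝ) : H1 Ω :=
  if h : ∃! ψ : H1 Ω, IsFirstEigenfunction σ κ Ω B ψ then h.choose else 0

/-! ### The sensitivity derivative and `φ` -/

/-- The sensitivity derivative `dψ₁/dB` at `B = 0` is well defined: for all small Biot numbers
`B ≥ 0` there is exactly one first eigenfunction `ψ₁(B)`, and `B ↦ ψ₁(B) ∈ H¹(Ω)` is differentiable
at `B = 0` (from the right, as Biot numbers are nonnegative). -/
def HasSensitivityDerivative (σ κ : Plane → ℝ) (Ω : Set Plane) : Prop :=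
  (∀ᶠ B in 𝓝[≥] (0 : ℝ), ∃! ψ : H1 Ω, IsFirstEigenfunction σ κ Ω B ψ) ∧
  DifferentiableWithinAt ℝ (firstEigenfunction σ κ Ω) (Ici 0) 0

/-- The sensitivity derivative `ψ'⁰ = dψ₁/dB` at `B = 0`. -/
def sensitivityDerivative (σ κ : Plane → ℝ) (Ω : Set Plane) : H1 Ω :=
  derivWithin (firstEigenfunction σ κ Ω) (Ici 0) 0

/-- `φ(σ, κ; Ω) = ∫_Ω κ ∇ψ'⁰ · ∇ψ'⁰`. -/
def phi (σ κ : Plane → ℝ) (Ω : Set Plane) : ℝ :=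
  formA0 κ (sensitivityDerivative σ κ Ω) (sensitivityDerivative σ κ Ω)

/-! ### Triangles -/

/-- The open triangle with vertices `p`, `q`, `r`. -/
def triangle (p q r : Plane) : Set Plane := interior (convexHull ℝ {p, q, r})

/-- The open right triangle with vertices `(0,0)`, `(W,0)`, `(0,1)`. -/
def rightTriangle (W : ℝ) : Set Plane := triangle !₂[0, 0] !₂[W, 0] !₂[0, 1]

end Dunking

end

/-! Write the weak problem as a pencil `A₀ + B A₁ - l M` (Dirichlet form, boundary mass, interior
mass) on the Hilbert space `H¹(T)` of a triangle `T`. At `B = 0` the eigenpair is the constant `ψ₀ =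
|T|^(-1/2)` with eigenvalue `0`. The Poincaré and trace inequalities make `A₀ + (M ψ₀)²` coercive
(`exists_coercivity`), so the linearized normalized equation is invertible. The implicit function
theorem then yields a differentiable branch of eigenpairs (`exists_eigenpair_branch`).

The branch must be identified with the first eigenfunction. Coercivity survives for small `B ≥ 0` as
a spectral gap (`eventually_spectral_gap`), which makes the branch eigenvalue least and simple.
Replacing `w` by `√(w² + ε²)` hardly increases the Rayleigh quotient, so by the gap `|ψ|` is a
multiple of `ψ` (`nonneg_of_gap`). Positive mass against `ψ₀` fixes the sign.

The derivative solves `A₀(ψ', v) + A₁(ψ₀, v) = l' M(ψ₀, v)`, that is `-Δψ' = l' ψ₀` with `∂ₙψ' =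
-ψ₀`. On a triangle with incenter `I` and inradius `ρ`, the normal component of `x - I` equals `ρ`
on every side. Hence `-(ψ₀ / 2ρ) |x - I|²` is a solution, with `l' = 2 / ρ`, and it has the same
gradient as `ψ'`. This gives `φ(T) = (|T| ρ²)⁻¹ ∫_T |x - I|²`, a quadratic integral computed in
barycentric coordinates (`phi_triangle`). The three claims are evaluations of that formula. -/

noncomputable section

namespace Dunking

/-! ### Perturbation of a simple lowest eigenvalue in a Hilbert space. -/

section Perturbation

variable {H : Type*} [NormedAddCommGroup H] [InnerProductSpace ℝ H]

/-- The residual of the normalized eigenvalue equation for the pencil `A₀ + B A₁ - l M`. -/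
def pencilResidual (A₀ A₁ M : H →L[ℝ] H →L[ℝ] ℝ) (x : ℝ × (H × ℝ)) : (H →L[ℝ] ℝ) × ℝ :=
  (A₀ x.2.1 + x.1 • A₁ x.2.1 - x.2.2 • M x.2.1, M x.2.1 x.2.1 - 1)

/-- The derivative of `pencilResidual` at `(0, ψ₀, 0)`. -/
def pencilDeriv (A₀ A₁ M : H →L[ℝ] H →L[ℝ] ℝ) (ψ₀ : H) :
    (ℝ × (H × ℝ)) →L[ℝ] (H →L[ℝ] ℝ) × ℝ :=
  (A₀.comp ((ContinuousLinearMap.fst ℝ H ℝ).comp (ContinuousLinearMap.snd ℝ ℝ (H × ℝ))) +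
      (ContinuousLinearMap.fst ℝ ℝ (H × ℝ)).smulRight (A₁ ψ₀) -
      ((ContinuousLinearMap.snd ℝ H ℝ).comp (ContinuousLinearMap.snd ℝ ℝ (H × ℝ))).smulRight
        (M ψ₀)).prod
    ((M ψ₀ + M.flip ψ₀).comp
      ((ContinuousLinearMap.fst ℝ H ℝ).comp (ContinuousLinearMap.snd ℝ ℝ (H × ℝ))))

lemma pencilDeriv_apply (A₀ A₁ M : H →L[ℝ] H →L[ℝ] ℝ) (ψ₀ : H) (b : ℝ) (h : H) (μ : ℝ) :
    pencilDeriv A₀ A₁ M ψ₀ (b, h, μ) =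
      (A₀ h + b • A₁ ψ₀ - μ • M ψ₀, M ψ₀ h + M h ψ₀) := by
  simp [pencilDeriv]

lemma hasStrictFDerivAt_pencilResidual (A₀ A₁ M : H →L[ℝ] H →L[ℝ] ℝ) (ψ₀ : H) :
    HasStrictFDerivAt (pencilResidual A₀ A₁ M) (pencilDeriv A₀ A₁ M ψ₀) (0, ψ₀, 0) := by
  have h1 : HasStrictFDerivAt (fun x : ℝ × (H × ℝ) => x.1)
      (ContinuousLinearMap.fst ℝ ℝ (H × ℝ)) (0, ψ₀, 0) := hasStrictFDerivAt_fst
  have h2 : HasStrictFDerivAt (fun x : ℝ × (H × ℝ) => x.2.1)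
      ((ContinuousLinearMap.fst ℝ H ℝ).comp (ContinuousLinearMap.snd ℝ ℝ (H × ℝ))) (0, ψ₀, 0) :=
    ((ContinuousLinearMap.fst ℝ H ℝ).comp
      (ContinuousLinearMap.snd ℝ ℝ (H × ℝ))).hasStrictFDerivAt
  have h3 : HasStrictFDerivAt (fun x : ℝ × (H × ℝ) => x.2.2)
      ((ContinuousLinearMap.snd ℝ H ℝ).comp (ContinuousLinearMap.snd ℝ ℝ (H × ℝ))) (0, ψ₀, 0) :=
    ((ContinuousLinearMap.snd ℝ H ℝ).comp
      (ContinuousLinearMap.snd ℝ ℝ (H × ℝ))).hasStrictFDerivAt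
  have hB : ∀ A : H →L[ℝ] H →L[ℝ] ℝ, HasStrictFDerivAt (fun x : ℝ × (H × ℝ) => A x.2.1)
      (A.comp ((ContinuousLinearMap.fst ℝ H ℝ).comp (ContinuousLinearMap.snd ℝ ℝ (H × ℝ))))
      (0, ψ₀, 0) := fun A => A.hasStrictFDerivAt.comp (0, ψ₀, 0) h2
  have key := (((hB A₀).add (h1.smul (hB A₁))).sub (h3.smul (hB M))).prodMk
    (((hB M).clm_apply h2).sub_const 1)
  refine key.congr_fderiv ?_
  ext x <;> simp [pencilDeriv]

/-- Near the unperturbed problem the eigenvalue of the branch is separated from the rest of the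
spectrum. -/
theorem eventually_spectral_gap {A₀ A₁ M : H →L[ℝ] H →L[ℝ] ℝ} {ψ₀ : H} {c : ℝ}
    (hA₀s : ∀ u v, A₀ u v = A₀ v u) (hA₁s : ∀ u v, A₁ u v = A₁ v u) (hMs : ∀ u v, M u v = M v u)
    (hA₁p : ∀ u, 0 ≤ A₁ u u) (hc : 0 < c)
    (hcoer : ∀ h, c * ‖h‖ ^ 2 ≤ A₀ h h + M ψ₀ h ^ 2) {ψ : ℝ → H} {l : ℝ → ℝ}
    (hψ : ContinuousAt ψ 0) (hl : ContinuousAt l 0) (hψ0 : ψ 0 = ψ₀) (hl0 : l 0 = 0)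
    (heig : ∀ᶠ B in 𝓝 (0 : ℝ), (∀ v, A₀ (ψ B) v + B * A₁ (ψ B) v = l B * M (ψ B) v) ∧
        M (ψ B) (ψ B) = 1) :
    ∀ᶠ B in 𝓝 (0 : ℝ), 0 ≤ B → ∀ w, c / 2 * ‖w - M (ψ B) w • ψ B‖ ^ 2 ≤
      A₀ w w + B * A₁ w w - l B * M w w := by
  -- These are the two errors made when the coercivity estimate at `B = 0` is used at `B`; together
  -- they cost at most half of `c`.
  have hsmall : ∀ᶠ B in 𝓝 (0 : ℝ), ‖M‖ ^ 2 * ‖ψ B - ψ₀‖ ^ 2 + |l B| * ‖M‖ < c / 2 := by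
    have : ContinuousAt (fun B => ‖M‖ ^ 2 * ‖ψ B - ψ₀‖ ^ 2 + |l B| * ‖M‖) 0 := by fun_prop
    refine this.eventually_lt continuousAt_const ?_
    simp [hψ0, hl0, hc]
  filter_upwards [hsmall, heig] with B hs hB hB0 w
  obtain ⟨he, hn⟩ := hB
  set a := M (ψ B) w with ha
  set h := w - a • ψ B with hh
  have hw : w = h + a • ψ B := by rw [hh]; abel
  have hMh : M (ψ B) h = 0 := by rw [hh]; simp [hn, ha]
  have hMh' : M h (ψ B) = 0 := by rw [hMs, hMh]
  have e1 := he h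
  have e2 := he (ψ B)
  have e3 : A₀ h (ψ B) = A₀ (ψ B) h := hA₀s _ _
  have e4 : A₁ h (ψ B) = A₁ (ψ B) h := hA₁s _ _
  -- In the `M`-orthogonal splitting `w = h + a ψ(B)` the eigenvalue equation kills the cross terms
  -- and the `ψ(B)` term, so the form only sees `h`.
  have hQ : A₀ w w + B * A₁ w w - l B * M w w = A₀ h h + B * A₁ h h - l B * M h h := by
    rw [hw]
    simp only [map_add, map_smul, add_apply, smul_apply,
      smul_eq_mul, e3, e4, hMh, hMh']
    rw [hMh] at e1
    linear_combination (2 * a) * e1 + a ^ 2 * e2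
  rw [hQ]
  have b1 : |M ψ₀ h| ≤ ‖M‖ * ‖ψ B - ψ₀‖ * ‖h‖ := by
    -- Since `h` is `M`-orthogonal to `ψ(B)`, its mass against `ψ₀` is of the order of `ψ(B) - ψ₀`.
    have : M ψ₀ h = - M (ψ B - ψ₀) h := by simp [hMh]
    rw [this, abs_neg, ← Real.norm_eq_abs]
    exact M.le_opNorm₂ _ _
  have b2 : M ψ₀ h ^ 2 ≤ ‖M‖ ^ 2 * ‖ψ B - ψ₀‖ ^ 2 * ‖h‖ ^ 2 := by
    rw [← sq_abs, ← mul_pow, ← mul_pow]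
    exact pow_le_pow_left₀ (abs_nonneg _) b1 2
  have b3 : l B * M h h ≤ |l B| * ‖M‖ * ‖h‖ ^ 2 := by
    have : |M h h| ≤ ‖M‖ * ‖h‖ * ‖h‖ := by
      rw [← Real.norm_eq_abs]; exact M.le_opNorm₂ _ _
    calc l B * M h h ≤ |l B| * |M h h| := by rw [← abs_mul]; exact le_abs_self _
      _ ≤ |l B| * (‖M‖ * ‖h‖ * ‖h‖) := by gcongr
      _ = _ := by ring
  have b4 := hcoer h
  have b5 : 0 ≤ B * A₁ h h := mul_nonneg hB0 (hA₁p h)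
  nlinarith [mul_nonneg (sub_nonneg.2 hs.le) (sq_nonneg ‖h‖)]

/-- With a spectral gap, the eigenvalue is the least one, and its eigenfunctions are multiples of
each other. -/
theorem least_eigenvalue_of_gap {A₀ A₁ M : H →L[ℝ] H →L[ℝ] ℝ} {B l c : ℝ} (hc : 0 < c) {ψ : H}
    (hn : M ψ ψ = 1)
    (hgap : ∀ w, c * ‖w - M ψ w • ψ‖ ^ 2 ≤ A₀ w w + B * A₁ w w - l * M w w) {χ : H} {l' : ℝ}
    (heχ : ∀ v, A₀ χ v + B * A₁ χ v = l' * M χ v) (hnχ : M χ χ = 1) :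
    l ≤ l' ∧ (l' ≤ l → 0 ≤ M ψ χ → χ = ψ) := by
  have h1 := hgap χ
  rw [heχ χ, hnχ] at h1
  refine ⟨?_, fun hle h0 => ?_⟩
  · have : 0 ≤ c * ‖χ - M ψ χ • ψ‖ ^ 2 := by positivity
    linarith
  -- With `l' ≤ l` the gap forces `χ` onto the line of `ψ`; normalization leaves the factor `±1`,
  -- and the sign condition selects `1`.
  · have h7 : ‖χ - M ψ χ • ψ‖ ^ 2 ≤ 0 := by
      by_contra hcon
      push Not at hcon
      linarith [mul_pos hc hcon]
    have h8 : χ = M ψ χ • ψ := sub_eq_zero.1 (norm_eq_zero.1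
      (pow_eq_zero_iff two_ne_zero |>.1 (le_antisymm h7 (sq_nonneg _))))
    have h9 : M χ χ = M ψ χ * M ψ χ := by
      conv_lhs => rw [h8]
      simp [hn]
    have h11 : M ψ χ = 1 := by nlinarith
    rw [h8, h11, one_smul]

/-- With a spectral gap, almost minimizers of the Rayleigh quotient are close to the line of the
eigenfunction. -/
theorem tendsto_sub_smul_of_gap {A₀ A₁ M : H →L[ℝ] H →L[ℝ] ℝ} {B l c : ℝ} (hB : 0 ≤ B)
    (hl : 0 ≤ l) (hc : 0 < c) {ψ : H} (he : ∀ v, A₀ ψ v + B * A₁ ψ v = l * M ψ v)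
    (hgap : ∀ w, c * ‖w - M ψ w • ψ‖ ^ 2 ≤ A₀ w w + B * A₁ w w - l * M w w)
    {w z : ℕ → H} (hw : Tendsto w atTop (𝓝 ψ)) {δ : ℕ → ℝ} (hδ : Tendsto δ atTop (𝓝 0))
    (h₀ : ∀ n, A₀ (z n) (z n) ≤ A₀ (w n) (w n)) (hm : ∀ n, M (w n) (w n) ≤ M (z n) (z n))
    (h₁ : ∀ n, A₁ (z n) (z n) ≤ A₁ (w n) (w n) + δ n) :
    Tendsto (fun n => z n - M ψ (z n) • ψ) atTop (𝓝 0) := by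
  set Q : H → ℝ := fun w => A₀ w w + B * A₁ w w - l * M w w with hQ
  have hQc : Continuous Q := by fun_prop
  have hQψ : Q ψ = 0 := by simp only [hQ]; rw [he ψ]; ring
  have hQw : Tendsto (fun n => Q (w n) + B * δ n) atTop (𝓝 0) := by
    have := ((hQc.tendsto ψ).comp hw).add (hδ.const_mul B)
    simpa [hQψ] using this
  -- Since `l ≥ 0`, increasing the mass can only lower `Q`; `B ≥ 0` is used in the same way for the
  -- boundary term.
  have hQz : ∀ n, Q (z n) ≤ Q (w n) + B * δ n := by
    intro n
    have k1 := mul_le_mul_of_nonneg_left (h₁ n) hB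
    have k2 := mul_le_mul_of_nonneg_left (hm n) hl
    have k3 := h₀ n
    simp only [hQ]
    linarith
  rw [tendsto_zero_iff_norm_tendsto_zero]
  have k1 : Tendsto (fun n => ‖z n - M ψ (z n) • ψ‖ ^ 2) atTop (𝓝 0) := by
    refine squeeze_zero (fun n => sq_nonneg _)
      (g := fun n => (Q (w n) + B * δ n) / c) (fun n => ?_) ?_
    · rw [le_div_iff₀ hc, mul_comm]
      exact (hgap (z n)).trans (hQz n)
    · simpa using hQw.div_const c
  have k2 := (Real.continuous_sqrt.tendsto 0).comp k1
  simpa [Function.comp_def, Real.sqrt_sq (norm_nonneg _)] using k2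

variable [CompleteSpace H]

/-- The partial derivative in `(ψ, l)` is the bordered operator `(h, μ) ↦ (A₀ h - μ M ψ₀, 2 M ψ₀
h)`. The kernel of `A₀` is the line of `ψ₀`; the border `μ` supplies the missing range and the
normalization removes the kernel. Its inverse is what the implicit function theorem needs. -/
lemma isInvertible_pencilDeriv {A₀ A₁ M : H →L[ℝ] H →L[ℝ] ℝ} {ψ₀ : H} {c : ℝ}
    (hA₀s : ∀ u v, A₀ u v = A₀ v u) (hMs : ∀ u v, M u v = M v u)
    (hA₀ : A₀ ψ₀ = 0) (hM : M ψ₀ ψ₀ = 1) (hc : 0 < c)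
    (hcoer : ∀ h, c * ‖h‖ ^ 2 ≤ A₀ h h + M ψ₀ h ^ 2) :
    (pencilDeriv A₀ A₁ M ψ₀ ∘L .inr ℝ ℝ (H × ℝ)).IsInvertible := by
  set D := pencilDeriv A₀ A₁ M ψ₀ ∘L .inr ℝ ℝ (H × ℝ) with hD
  have hDa : ∀ (h : H) (μ : ℝ), D (h, μ) = (A₀ h - μ • M ψ₀, 2 * M ψ₀ h) := by
    intro h μ
    have : D (h, μ) = pencilDeriv A₀ A₁ M ψ₀ (0, h, μ) := by simp [hD]
    rw [this, pencilDeriv_apply, hMs h ψ₀]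
    simp [two_mul]
  have hA₀' : ∀ h, A₀ h ψ₀ = 0 := fun h => by rw [hA₀s, hA₀]; rfl
  have hinj : D.ker = ⊥ := by
    rw [LinearMap.ker_eq_bot']
    rintro ⟨h, μ⟩ hx
    have hx' : D (h, μ) = 0 := hx
    rw [hDa, Prod.mk_eq_zero] at hx'
    obtain ⟨e1, e2⟩ := hx'
    have e2' : M ψ₀ h = 0 := by linarith
    have e3 := congrArg (fun l : H →L[ℝ] ℝ => l ψ₀) e1
    -- Testing with `ψ₀` gives `μ = 0`; testing with `h` then gives `A₀ h h = 0`, and coercivity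
    -- gives `h = 0`.
    simp [hA₀', hM] at e3
    have e4 := congrArg (fun l : H →L[ℝ] ℝ => l h) e1
    simp [e3] at e4
    have e5 := hcoer h
    rw [e4, e2'] at e5
    have : ‖h‖ ^ 2 ≤ 0 := by
      by_contra hcon
      push Not at hcon
      nlinarith [mul_pos hc hcon]
    have : ‖h‖ = 0 := by nlinarith [norm_nonneg h, sq_nonneg ‖h‖]
    simp [norm_eq_zero.1 this, e3]
  -- Adding the rank-one form `M ψ₀ ⊗ M ψ₀` makes `A₀` coercive, so Lax–Milgram applies.
  let C : H →L[ℝ] H →L[ℝ] ℝ := A₀ + (M ψ₀).smulRight (M ψ₀)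
  have hC : ∀ u v, C u v = A₀ u v + M ψ₀ u * M ψ₀ v := fun u v => by simp [C]
  have hCc : IsCoercive C := ⟨c, hc, fun u => by
    have := hcoer u
    rw [hC]; nlinarith⟩
  have hsurj : D.range = ⊤ := by
    rw [LinearMap.range_eq_top]
    rintro ⟨l, s⟩
    let w := (InnerProductSpace.toDual ℝ H).symm l
    let g := hCc.continuousLinearEquivOfBilin.symm w
    have hg : ∀ v, A₀ g v + M ψ₀ g * M ψ₀ v = l v := by
      intro v
      rw [← hC, ← hCc.continuousLinearEquivOfBilin_apply]
      simp [g, w]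
    have hg0 : M ψ₀ g = l ψ₀ := by
      have := hg ψ₀
      rwa [hA₀', hM, zero_add, mul_one] at this
    -- As `M ψ₀ g = l ψ₀`, the rank-one term in the equation of `g` is cancelled by `μ = -l ψ₀`. A
    -- multiple of `ψ₀`, invisible to `A₀`, then adjusts the second component to `s`.
    refine ⟨(g + (s / 2 - l ψ₀) • ψ₀, - l ψ₀), ?_⟩
    change D _ = _
    rw [hDa, Prod.mk.injEq]
    constructor
    · ext v
      have := hg v
      rw [hg0] at this
      simp [hA₀]
      linarith
    · simp [hM, hg0]
      ring
  exact ⟨ContinuousLinearEquiv.ofBijective D hinj hsurj, by ext <;> simp⟩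

/-- A simple isolated eigenvalue at the bottom of the spectrum continues to a branch of normalized
eigenpairs, differentiable at the unperturbed problem. -/
theorem exists_eigenpair_branch {A₀ A₁ M : H →L[ℝ] H →L[ℝ] ℝ} {ψ₀ : H} {c : ℝ}
    (hA₀s : ∀ u v, A₀ u v = A₀ v u) (hMs : ∀ u v, M u v = M v u)
    (hA₀ : A₀ ψ₀ = 0) (hM : M ψ₀ ψ₀ = 1) (hc : 0 < c)
    (hcoer : ∀ h, c * ‖h‖ ^ 2 ≤ A₀ h h + M ψ₀ h ^ 2) :
    ∃ (ψ : ℝ → H) (l : ℝ → ℝ) (ψ' : H) (l' : ℝ), HasDerivAt ψ ψ' 0 ∧ ContinuousAt l 0 ∧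
      ψ 0 = ψ₀ ∧ l 0 = 0 ∧
      (∀ᶠ B in 𝓝 (0 : ℝ), (∀ v, A₀ (ψ B) v + B * A₁ (ψ B) v = l B * M (ψ B) v) ∧
        M (ψ B) (ψ B) = 1) ∧
      ∀ v, A₀ ψ' v + A₁ ψ₀ v = l' * M ψ₀ v := by
  have hd := hasStrictFDerivAt_pencilResidual A₀ A₁ M ψ₀
  have hi := isInvertible_pencilDeriv (A₁ := A₁) hA₀s hMs hA₀ hM hc hcoer
  set Ψ := hd.implicitFunctionOfProdDomain hi with hΨ
  have h0 : Ψ 0 = (ψ₀, 0) :=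
    (hd.eventually_apply_eq_iff_implicitFunctionOfProdDomain hi).self_of_nhds.mp rfl
  have hev := hd.eventually_apply_implicitFunctionOfProdDomain hi
  have hder := (hd.hasStrictFDerivAt_implicitFunctionOfProdDomain hi).hasFDerivAt
  rw [← hΨ] at hder hev
  set E := -(pencilDeriv A₀ A₁ M ψ₀ ∘L .inr ℝ ℝ (H × ℝ)).inverse ∘L
    (pencilDeriv A₀ A₁ M ψ₀ ∘L .inl ℝ ℝ (H × ℝ)) with hE
  have hz : pencilResidual A₀ A₁ M (0, ψ₀, 0) = 0 := by simp [pencilResidual, hA₀, hM]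
  rw [hz] at hev
  -- Implicit differentiation: the velocity `E 1` of the branch, with `B` moving at unit speed, lies
  -- in the kernel of the full derivative.
  have hlin : pencilDeriv A₀ A₁ M ψ₀ (1, (E 1).1, (E 1).2) = 0 := by
    have h1 : (pencilDeriv A₀ A₁ M ψ₀ ∘L .inr ℝ ℝ (H × ℝ)) (E 1) =
        - pencilDeriv A₀ A₁ M ψ₀ (1, 0) := by
      obtain ⟨e, he⟩ := hi
      rw [hE, ← he]
      simp
    have h2 : pencilDeriv A₀ A₁ M ψ₀ (1, E 1) =
        pencilDeriv A₀ A₁ M ψ₀ (1, 0) + pencilDeriv A₀ A₁ M ψ₀ (0, E 1) := by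
      rw [← map_add]; simp
    have h3 : pencilDeriv A₀ A₁ M ψ₀ (0, E 1) = - pencilDeriv A₀ A₁ M ψ₀ (1, 0) := by
      rw [← h1]; simp
    change pencilDeriv A₀ A₁ M ψ₀ (1, E 1) = 0
    rw [h2, h3, add_neg_cancel]
  refine ⟨fun B => (Ψ B).1, fun B => (Ψ B).2, (E 1).1, (E 1).2, ?_, ?_, by simp [h0], by simp [h0],
    ?_, ?_⟩
  · have := hder.fst.hasDerivAt
    simpa using this
  · exact hder.continuousAt.snd
  · filter_upwards [hev] with B hB
    simp only [pencilResidual, Prod.mk_eq_zero] at hB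
    refine ⟨fun v => ?_, by linarith [hB.2]⟩
    have := congrArg (fun l : H →L[ℝ] ℝ => l v) hB.1
    simp at this
    linarith
  · intro v
    rw [pencilDeriv_apply, Prod.mk_eq_zero] at hlin
    have := congrArg (fun l : H →L[ℝ] ℝ => l v) hlin.1
    simp at this
    linarith

end Perturbation

/-! ### Triangles in affine coordinates: area, sides and arc length. -/

section Geometry

/-- The determinant of two vectors of the plane. -/
def cross (a b : Plane) : ℝ := a 0 * b 1 - a 1 * b 0

/-- The open standard triangle in the parameter plane. -/
def stdTriangle : Set (ℝ × ℝ) := {z | 0 < z.1 ∧ 0 < z.2 ∧ z.1 + z.2 < 1}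

/-- The closed standard triangle in the parameter plane. -/
def closedStdTriangle : Set (ℝ × ℝ) := {z | 0 ≤ z.1 ∧ 0 ≤ z.2 ∧ z.1 + z.2 ≤ 1}

/-- The affine parametrization of the plane sending the standard triangle to the triangle
`p q r`. -/
def param (p q r : Plane) (z : ℝ × ℝ) : Plane := p + z.1 • (q - p) + z.2 • (r - p)

lemma continuous_param (p q r : Plane) : Continuous (param p q r) := by
  unfold param; fun_prop

lemma isClosed_closedStdTriangle : IsClosed closedStdTriangle := by
  unfold closedStdTriangle
  exact (isClosed_le continuous_const continuous_fst).inter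
    ((isClosed_le continuous_const continuous_snd).inter
      (isClosed_le (continuous_fst.add continuous_snd) continuous_const))

lemma isOpen_stdTriangle : IsOpen stdTriangle := by
  unfold stdTriangle
  exact (isOpen_lt continuous_const continuous_fst).inter
    ((isOpen_lt continuous_const continuous_snd).inter
      (isOpen_lt (continuous_fst.add continuous_snd) continuous_const))

lemma convex_closedStdTriangle : Convex ℝ closedStdTriangle := by
  rintro ⟨a1, a2⟩ ⟨h1, h2, h3⟩ ⟨b1, b2⟩ ⟨k1, k2, k3⟩ s t hs ht hst
  simp only [closedStdTriangle, mem_ofPred_eq, Prod.smul_mk, Prod.mk_add_mk, smul_eq_mul] at *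
  refine ⟨by positivity, by positivity, ?_⟩
  nlinarith [mul_nonneg hs (sub_nonneg.2 h3), mul_nonneg ht (sub_nonneg.2 k3)]

lemma interior_closedStdTriangle : interior closedStdTriangle = stdTriangle := by
  have h : closedStdTriangle = (Prod.fst ⁻¹' Ici 0 ∩ Prod.snd ⁻¹' Ici 0) ∩
      (ContinuousLinearMap.fst ℝ ℝ ℝ + ContinuousLinearMap.snd ℝ ℝ ℝ) ⁻¹' Iic 1 := by
    ext z; simp [closedStdTriangle, and_assoc]
  have hs : Function.Surjective
      (ContinuousLinearMap.fst ℝ ℝ ℝ + ContinuousLinearMap.snd ℝ ℝ ℝ) :=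
    fun t => ⟨(t, 0), by simp⟩
  rw [h, interior_inter, interior_inter,
    ← isOpenMap_fst.preimage_interior_eq_interior_preimage continuous_fst,
    ← isOpenMap_snd.preimage_interior_eq_interior_preimage continuous_snd,
    ← (ContinuousLinearMap.isOpenMap _ hs).preimage_interior_eq_interior_preimage
      (ContinuousLinearMap.continuous _), interior_Ici, interior_Iic]
  ext z; simp [stdTriangle, and_assoc]

lemma stdTriangle_nonempty : stdTriangle.Nonempty :=
  ⟨(1 / 4, 1 / 4), by norm_num [stdTriangle]⟩

lemma closure_stdTriangle : closure stdTriangle = closedStdTriangle := by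
  rw [← interior_closedStdTriangle,
    convex_closedStdTriangle.closure_interior_eq_closure_of_nonempty_interior,
    isClosed_closedStdTriangle.closure_eq]
  rw [interior_closedStdTriangle]
  exact stdTriangle_nonempty

lemma frontier_stdTriangle : frontier stdTriangle =
    {z | z ∈ closedStdTriangle ∧ (z.1 = 0 ∨ z.2 = 0 ∨ z.1 + z.2 = 1)} := by
  rw [frontier, closure_stdTriangle, isOpen_stdTriangle.interior_eq]
  ext ⟨x, y⟩
  simp only [stdTriangle, closedStdTriangle, Set.mem_sdiff, mem_ofPred_eq]
  constructor
  · rintro ⟨⟨h1, h2, h3⟩, h4⟩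
    refine ⟨⟨h1, h2, h3⟩, ?_⟩
    by_contra hcon
    push Not at hcon
    exact h4 ⟨lt_of_le_of_ne h1 (Ne.symm hcon.1), lt_of_le_of_ne h2 (Ne.symm hcon.2.1),
      lt_of_le_of_ne h3 hcon.2.2⟩
  · rintro ⟨h, h4⟩
    refine ⟨h, fun ⟨k1, k2, k3⟩ => ?_⟩
    rcases h4 with h4 | h4 | h4 <;> linarith

lemma isBounded_closedStdTriangle : Bornology.IsBounded closedStdTriangle := by
  refine (Metric.isBounded_Icc (0 : ℝ × ℝ) (1, 1)).subset ?_
  rintro ⟨x, y⟩ ⟨h1, h2, h3⟩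
  simp only at h1 h2 h3
  exact ⟨⟨h1, h2⟩, ⟨by simp only; linarith, by simp only; linarith⟩⟩

/-- `param` as a homeomorphism, for a nondegenerate triangle. -/
def paramHomeomorph (p q r : Plane) (h : cross (q - p) (r - p) ≠ 0) : ℝ × ℝ ≃ₜ Plane where
  toFun := param p q r
  invFun x := (cross (x - p) (r - p) / cross (q - p) (r - p),
    cross (q - p) (x - p) / cross (q - p) (r - p))
  left_inv := by
    rintro ⟨a, b⟩
    simp only [Prod.mk.injEq, div_eq_iff h]
    simp only [cross, param, PiLp.add_apply, PiLp.smul_apply, PiLp.sub_apply, smul_eq_mul]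
    constructor <;> ring
  right_inv := by
    intro x
    ext i
    simp only [param, PiLp.add_apply, PiLp.smul_apply, PiLp.sub_apply, smul_eq_mul]
    field_simp
    fin_cases i <;> simp [cross] <;> ring
  continuous_toFun := continuous_param p q r
  continuous_invFun := by
    unfold cross
    fun_prop

lemma coe_paramHomeomorph (p q r : Plane) (h : cross (q - p) (r - p) ≠ 0) :
    ⇑(paramHomeomorph p q r h) = param p q r := rfl

lemma param_combination (p q r : Plane) (z : ℝ × ℝ) :
    param p q r z = (1 - z.1 - z.2) • p + z.1 • q + z.2 • r := by
  unfold param; module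

lemma convexHull_eq_image_param (p q r : Plane) :
    convexHull ℝ {p, q, r} = param p q r '' closedStdTriangle := by
  apply Subset.antisymm
  · refine convexHull_min ?_ ?_
    · rintro x (rfl | rfl | rfl)
      · exact ⟨(0, 0), by simp [closedStdTriangle], by simp [param]⟩
      · exact ⟨(1, 0), by simp [closedStdTriangle], by simp [param]⟩
      · exact ⟨(0, 1), by simp [closedStdTriangle], by simp [param]⟩
    · rintro _ ⟨a, ha, rfl⟩ _ ⟨b, hb, rfl⟩ s t hs ht hst
      refine ⟨s • a + t • b, convex_closedStdTriangle ha hb hs ht hst, ?_⟩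
      simp only [param_combination, Prod.fst_add, Prod.snd_add, Prod.smul_fst, Prod.smul_snd,
        smul_eq_mul]
      obtain rfl : t = 1 - s := by linarith
      module
  · rintro _ ⟨⟨x, y⟩, ⟨h1, h2, h3⟩, rfl⟩
    simp only at h1 h2 h3
    have hc := convex_convexHull ℝ ({p, q, r} : Set Plane)
    rw [param_combination]
    have hp : p ∈ convexHull ℝ ({p, q, r} : Set Plane) := subset_convexHull _ _ (by simp)
    have hq : q ∈ convexHull ℝ ({p, q, r} : Set Plane) := subset_convexHull _ _ (by simp)
    have hr : r ∈ convexHull ℝ ({p, q, r} : Set Plane) := subset_convexHull _ _ (by simp)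
    have := hc.sum_mem (t := (Finset.univ : Finset (Fin 3))) (w := ![1 - x - y, x, y])
      (z := ![p, q, r]) (by
        intro i _
        fin_cases i
        · simp; linarith
        · simpa using h1
        · simpa using h2) (by simp [Fin.sum_univ_three]; ring) (by
        intro i _
        fin_cases i
        · simpa using hp
        · simpa using hq
        · simpa using hr)
    simpa [Fin.sum_univ_three] using this

variable {p q r : Plane}

lemma triangle_eq_image_param (h : cross (q - p) (r - p) ≠ 0) :
    triangle p q r = param p q r '' stdTriangle := by
  rw [triangle, convexHull_eq_image_param, ← coe_paramHomeomorph p q r h,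
    ← Homeomorph.image_interior, interior_closedStdTriangle]

lemma preimage_param_triangle (h : cross (q - p) (r - p) ≠ 0) :
    param p q r ⁻¹' triangle p q r = stdTriangle := by
  rw [triangle_eq_image_param h]
  exact preimage_image_eq _ (paramHomeomorph p q r h).injective

lemma isOpen_triangle (p q r : Plane) : IsOpen (triangle p q r) := isOpen_interior

lemma convex_triangle (p q r : Plane) : Convex ℝ (triangle p q r) :=
  (convex_convexHull ℝ _).interior

lemma isBounded_triangle (p q r : Plane) : Bornology.IsBounded (triangle p q r) :=
  (isBounded_convexHull.2 (by simp)).subset interior_subset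

lemma mem_segment_iff_param {a b x : Plane} :
    x ∈ segment ℝ a b ↔ ∃ t ∈ Icc (0 : ℝ) 1, AffineMap.lineMap a b t = x := by
  rw [segment_eq_image_lineMap]; rfl

lemma lineMap_eq_param_zero_right (p q r : Plane) (t : ℝ) :
    AffineMap.lineMap p q t = param p q r (t, 0) := by
  simp [AffineMap.lineMap_apply, param, add_comm]

lemma lineMap_eq_param_zero_left (p q r : Plane) (t : ℝ) :
    AffineMap.lineMap p r t = param p q r (0, t) := by
  simp [AffineMap.lineMap_apply, param, add_comm]

lemma lineMap_eq_param_hypotenuse (p q r : Plane) (t : ℝ) :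
    AffineMap.lineMap q r t = param p q r (1 - t, t) := by
  simp only [AffineMap.lineMap_apply, param, vsub_eq_sub, vadd_eq_add]
  module

lemma frontier_triangle (h : cross (q - p) (r - p) ≠ 0) :
    frontier (triangle p q r) = segment ℝ p q ∪ (segment ℝ q r ∪ segment ℝ p r) := by
  rw [triangle_eq_image_param h, ← coe_paramHomeomorph p q r h, ← Homeomorph.image_frontier,
    frontier_stdTriangle, coe_paramHomeomorph]
  ext x
  simp only [mem_union, mem_segment_iff_param]
  constructor
  · rintro ⟨⟨a, b⟩, ⟨⟨h1, h2, h3⟩, h4⟩, rfl⟩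
    simp only at h1 h2 h3 h4
    rcases h4 with rfl | rfl | h4
    · exact Or.inr (Or.inr ⟨b, ⟨h2, by linarith⟩, lineMap_eq_param_zero_left _ _ _ _⟩)
    · exact Or.inl ⟨a, ⟨h1, by linarith⟩, lineMap_eq_param_zero_right _ _ _ _⟩
    · obtain rfl : a = 1 - b := by linarith
      exact Or.inr (Or.inl ⟨b, ⟨h2, by linarith⟩, lineMap_eq_param_hypotenuse _ _ _ _⟩)
  · rintro (⟨t, ⟨h1, h2⟩, rfl⟩ | ⟨t, ⟨h1, h2⟩, rfl⟩ | ⟨t, ⟨h1, h2⟩, rfl⟩)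
    · exact ⟨(t, 0), ⟨⟨h1, le_rfl, by simpa using h2⟩, by simp⟩,
        (lineMap_eq_param_zero_right _ _ _ _).symm⟩
    · exact ⟨(1 - t, t), ⟨⟨by simpa using h2, h1, by simp⟩, by simp⟩,
        (lineMap_eq_param_hypotenuse _ _ _ _).symm⟩
    · exact ⟨(0, t), ⟨⟨le_rfl, h1, by simpa using h2⟩, by simp⟩,
        (lineMap_eq_param_zero_left _ _ _ _).symm⟩

/-- Arc length on a segment is a multiple of the image of Lebesgue measure. -/
lemma hausdorffMeasure_restrict_segment (a b : Plane) :
    (Measure.hausdorffMeasure 1 : Measure Plane).restrict (segment ℝ a b) =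
      nndist a b • (volume.restrict (Icc (0 : ℝ) 1)).map (AffineMap.lineMap a b) := by
  have hm : Measurable (AffineMap.lineMap a b : ℝ → Plane) :=
    (AffineMap.lineMap_continuous (R := ℝ) (p := a) (q := b)).measurable
  ext s hs
  rw [Measure.restrict_apply hs, Measure.smul_apply, Measure.map_apply hm hs,
    Measure.restrict_apply (hm hs), segment_eq_image_lineMap, inter_comm s,
    ← image_inter_preimage, hausdorffMeasure_lineMap_image, hausdorffMeasure_real,
    inter_comm]

/-- Arc length on the boundary of a triangle. -/
lemma boundaryMeasure_triangle (h : cross (q - p) (r - p) ≠ 0) :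
    boundaryMeasure (triangle p q r) =
      nndist p q • (volume.restrict (Icc (0 : ℝ) 1)).map (AffineMap.lineMap p q) +
      (nndist q r • (volume.restrict (Icc (0 : ℝ) 1)).map (AffineMap.lineMap q r) +
      nndist p r • (volume.restrict (Icc (0 : ℝ) 1)).map (AffineMap.lineMap p r)) := by
  have hmeas : ∀ a b : Plane, MeasurableSet (segment ℝ a b) := fun a b => by
    rw [segment_eq_image_lineMap]
    exact (isCompact_Icc.image AffineMap.lineMap_continuous).measurableSet
  have hinj := (paramHomeomorph p q r h).injective
  rw [coe_paramHomeomorph] at hinj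
  -- Two sides share only a vertex, which has zero length, so the measures of the sides add.
  have := Measure.nullSingletonClass_hausdorff Plane one_pos
  have hd : ∀ {s t : Set Plane} {a : Plane}, s ∩ t ⊆ {a} →
      (Measure.hausdorffMeasure 1 : Measure Plane) (s ∩ t) = 0 := fun hst =>
    measure_mono_null hst (measure_singleton _)
  rw [boundaryMeasure, frontier_triangle h, Measure.restrict_union₀, Measure.restrict_union₀,
    hausdorffMeasure_restrict_segment, hausdorffMeasure_restrict_segment,
    hausdorffMeasure_restrict_segment]
  · refine hd (a := r) ?_
    rintro x ⟨h1, h2⟩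
    obtain ⟨s, hs, rfl⟩ := mem_segment_iff_param.1 h1
    obtain ⟨t, ht, h3⟩ := mem_segment_iff_param.1 h2
    rw [lineMap_eq_param_zero_left p q r, lineMap_eq_param_hypotenuse p q r] at h3
    have := hinj h3
    simp only [Prod.mk.injEq] at this
    have h4 : s = 1 := by linarith [this.1]
    simp [h4]
  · exact (hmeas _ _).nullMeasurableSet
  · rw [AEDisjoint, inter_union_distrib_left, measure_union_null_iff]
    refine ⟨hd (a := q) ?_, hd (a := p) ?_⟩
    · rintro x ⟨h1, h2⟩
      obtain ⟨s, hs, rfl⟩ := mem_segment_iff_param.1 h1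
      obtain ⟨t, ht, h3⟩ := mem_segment_iff_param.1 h2
      rw [lineMap_eq_param_zero_right p q r, lineMap_eq_param_hypotenuse p q r] at h3
      have := hinj h3
      simp only [Prod.mk.injEq] at this
      have h4 : s = 1 := by linarith [this.1, this.2]
      simp [h4]
    · rintro x ⟨h1, h2⟩
      obtain ⟨s, hs, rfl⟩ := mem_segment_iff_param.1 h1
      obtain ⟨t, ht, h3⟩ := mem_segment_iff_param.1 h2
      rw [lineMap_eq_param_zero_right p q r, lineMap_eq_param_zero_left p q r] at h3
      have := hinj h3
      simp only [Prod.mk.injEq] at this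
      have h4 : s = 0 := by linarith [this.1, this.2]
      simp [h4]
  · exact ((hmeas _ _).union (hmeas _ _)).nullMeasurableSet

/-- `param` is a translation after the linear map with columns `q - p` and `r - p`, whose
determinant is the cross product. -/
lemma map_param_volume (h : cross (q - p) (r - p) ≠ 0) :
    (volume : Measure (ℝ × ℝ)).map (param p q r) =
      ENNReal.ofReal |(cross (q - p) (r - p))⁻¹| • (volume : Measure Plane) := by
  let N : Matrix (Fin 2) (Fin 2) ℝ := !![(q - p) 0, (r - p) 0; (q - p) 1, (r - p) 1]
  have hN : N.det = cross (q - p) (r - p) := by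
    simp [N, Matrix.det_fin_two, cross]; ring
  have hcomp : param p q r = (fun x : Plane => p + x) ∘ (WithLp.toLp 2) ∘ (Matrix.toLin' N) ∘
      (MeasurableEquiv.finTwoArrow (α := ℝ)).symm := by
    funext z
    ext i
    fin_cases i <;>
      simp [param, N, Matrix.toLin'_apply, MeasurableEquiv.finTwoArrow] <;> ring
  have m1 : Measurable (Matrix.toLin' N) :=
    (LinearMap.continuous_of_finiteDimensional _).measurable
  have m2 : Measurable (WithLp.toLp 2 : (Fin 2 → ℝ) → Plane) :=
    (PiLp.volume_preserving_toLp (Fin 2)).measurable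
  have m3 : Measurable (fun x : Plane => p + x) := measurable_const_add p
  have m4 : Measurable (MeasurableEquiv.finTwoArrow (α := ℝ)).symm := MeasurableEquiv.measurable _
  rw [hcomp, ← Measure.map_map m3 (m2.comp (m1.comp m4)), ← Measure.map_map m2 (m1.comp m4),
    ← Measure.map_map m1 m4, ((volume_preserving_finTwoArrow ℝ).symm _).map_eq,
    Real.map_matrix_volume_pi_eq_smul_volume_pi (by rwa [hN]), Measure.map_smul,
    (PiLp.volume_preserving_toLp (Fin 2)).map_eq, Measure.map_smul, hN, map_add_left_eq_self]

lemma interiorMeasure_triangle (h : cross (q - p) (r - p) ≠ 0) :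
    interiorMeasure (triangle p q r) = ENNReal.ofReal |cross (q - p) (r - p)| •
      ((volume : Measure (ℝ × ℝ)).restrict stdTriangle).map (param p q r) := by
  have e1 : ENNReal.ofReal |cross (q - p) (r - p)| *
      ENNReal.ofReal |(cross (q - p) (r - p))⁻¹| = 1 := by
    rw [← ENNReal.ofReal_mul (abs_nonneg _), ← abs_mul, mul_inv_cancel₀ h]; simp
  have hmeas := (isOpen_triangle p q r).measurableSet
  rw [← preimage_param_triangle h, ← Measure.restrict_map (continuous_param p q r).measurable hmeas,
    map_param_volume h, Measure.restrict_smul, smul_smul, e1, one_smul]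

/-- Integrals over a triangle in affine coordinates. -/
lemma setIntegral_triangle {E : Type*} [NormedAddCommGroup E] [NormedSpace ℝ E]
    (h : cross (q - p) (r - p) ≠ 0) (g : Plane → E) :
    ∫ x in triangle p q r, g x =
      |cross (q - p) (r - p)| • ∫ z in stdTriangle, g (param p q r z) := by
  have := interiorMeasure_triangle h
  rw [interiorMeasure] at this
  rw [this, integral_smul_measure, ENNReal.toReal_ofReal (abs_nonneg _),
    ← coe_paramHomeomorph p q r h, (paramHomeomorph p q r h).measurableEmbedding.integral_map]

/-- Integrals over the boundary of a triangle. -/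
lemma integral_boundary_triangle (h : cross (q - p) (r - p) ≠ 0) {g : Plane → ℝ}
    (hg : Continuous g) :
    ∫ x, g x ∂(boundaryMeasure (triangle p q r)) =
      dist p q * (∫ t in (0 : ℝ)..1, g (param p q r (t, 0))) +
      (dist q r * (∫ t in (0 : ℝ)..1, g (param p q r (1 - t, t))) +
      dist p r * (∫ t in (0 : ℝ)..1, g (param p q r (0, t)))) := by
  have hm : ∀ a b : Plane, Measurable (AffineMap.lineMap a b : ℝ → Plane) := fun a b =>
    (AffineMap.lineMap_continuous (R := ℝ) (p := a) (q := b)).measurable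
  have hc : ∀ a b : Plane, Continuous fun t : ℝ => g (AffineMap.lineMap a b t) := fun a b =>
    hg.comp AffineMap.lineMap_continuous
  have hi : ∀ a b : Plane, Integrable g
      (nndist a b • (volume.restrict (Icc (0 : ℝ) 1)).map (AffineMap.lineMap a b)) := by
    intro a b
    refine Integrable.smul_measure_nnreal ?_
    rw [integrable_map_measure hg.aestronglyMeasurable (hm a b).aemeasurable]
    exact (hc a b).integrableOn_Icc
  have he : ∀ a b : Plane, ∫ x, g x
      ∂(nndist a b • (volume.restrict (Icc (0 : ℝ) 1)).map (AffineMap.lineMap a b)) =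
      dist a b * ∫ t in (0 : ℝ)..1, g (AffineMap.lineMap a b t) := by
    intro a b
    rw [integral_smul_nnreal_measure, integral_map (hm a b).aemeasurable hg.aestronglyMeasurable,
      intervalIntegral.integral_of_le zero_le_one, integral_Icc_eq_integral_Ioc]
    rfl
  rw [boundaryMeasure_triangle h, integral_add_measure (hi _ _) ((hi _ _).add_measure (hi _ _)),
    integral_add_measure (hi _ _) (hi _ _), he, he, he]
  simp only [lineMap_eq_param_zero_right p q r, lineMap_eq_param_zero_left p q r,
    lineMap_eq_param_hypotenuse p q r]

lemma isFiniteMeasure_boundaryMeasure_triangle (h : cross (q - p) (r - p) ≠ 0) :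
    IsFiniteMeasure (boundaryMeasure (triangle p q r)) := by
  rw [boundaryMeasure_triangle h]
  infer_instance

lemma triangle_nonempty (h : cross (q - p) (r - p) ≠ 0) : (triangle p q r).Nonempty := by
  rw [triangle_eq_image_param h]
  exact stdTriangle_nonempty.image _

end Geometry

/-! ### Divergence theorem about the incenter, and the trace inequality. -/

section Gauss

lemma integrableOn_stdTriangle {g : ℝ × ℝ → ℝ} (hg : Continuous g) :
    IntegrableOn g stdTriangle := by
  have hc : IsCompact closedStdTriangle :=
    Metric.isCompact_of_isClosed_isBounded isClosed_closedStdTriangle isBounded_closedStdTriangle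
  exact (hg.continuousOn.integrableOn_compact hc).mono_set
    (closure_stdTriangle ▸ subset_closure)

lemma setIntegral_stdTriangle {g : ℝ × ℝ → ℝ} (hg : Continuous g) :
    ∫ z in stdTriangle, g z = ∫ x in (0 : ℝ)..1, ∫ y in (0 : ℝ)..(1 - x), g (x, y) := by
  have hm := isOpen_stdTriangle.measurableSet
  have hi : Integrable (stdTriangle.indicator g) (volume : Measure (ℝ × ℝ)) :=
    (integrable_indicator_iff hm).2 (integrableOn_stdTriangle hg)
  rw [← integral_indicator hm, Measure.volume_eq_prod, integral_prod _ hi,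
    intervalIntegral.integral_of_le zero_le_one, integral_Ioc_eq_integral_Ioo,
    ← integral_indicator measurableSet_Ioo]
  congr 1
  funext x
  by_cases hx : x ∈ Ioo (0 : ℝ) 1
  · rw [indicator_of_mem hx, intervalIntegral.integral_of_le (by linarith [hx.2]),
      integral_Ioc_eq_integral_Ioo, ← integral_indicator measurableSet_Ioo]
    congr 1
    funext y
    by_cases hy : y ∈ Ioo (0 : ℝ) (1 - x)
    · rw [indicator_of_mem hy, indicator_of_mem]
      exact ⟨hx.1, hy.1, by simp only; linarith [hy.2]⟩
    · rw [indicator_of_notMem hy, indicator_of_notMem]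
      rintro ⟨h1, h2, h3⟩
      simp only at h1 h2 h3
      exact hy ⟨h2, by linarith⟩
  · rw [indicator_of_notMem hx]
    convert integral_zero ℝ ℝ with y
    rw [indicator_of_notMem]
    rintro ⟨h1, h2, h3⟩
    simp only at h1 h2 h3
    exact hx ⟨h1, by linarith⟩

lemma setIntegral_stdTriangle_swap (g : ℝ × ℝ → ℝ) :
    ∫ z in stdTriangle, g z.swap = ∫ z in stdTriangle, g z := by
  have hmp : MeasurePreserving (Prod.swap : ℝ × ℝ → ℝ × ℝ) volume volume := by
    rw [Measure.volume_eq_prod]; exact Measure.measurePreserving_swap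
  have := hmp.setIntegral_preimage_emb
    (MeasurableEquiv.prodComm (α := ℝ) (β := ℝ)).measurableEmbedding g stdTriangle
  rw [← this]
  congr 2
  ext z
  simp [stdTriangle, and_left_comm, add_comm]

lemma setIntegral_stdTriangle_deriv_snd {g G : ℝ × ℝ → ℝ} (hg : Continuous g)
    (hG : ∀ x y, HasDerivAt (fun t => G (x, t)) (g (x, y)) y) :
    ∫ z in stdTriangle, g z = ∫ x in (0 : ℝ)..1, (G (x, 1 - x) - G (x, 0)) := by
  rw [setIntegral_stdTriangle hg]
  congr 1
  funext x
  rw [intervalIntegral.integral_eq_sub_of_hasDerivAt (fun y _ => hG x y)]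
  exact Continuous.intervalIntegrable (by fun_prop) _ _

lemma setIntegral_stdTriangle_deriv_fst {g G : ℝ × ℝ → ℝ} (hg : Continuous g)
    (hG : ∀ x y, HasDerivAt (fun t => G (t, y)) (g (x, y)) x) :
    ∫ z in stdTriangle, g z = ∫ y in (0 : ℝ)..1, (G (1 - y, y) - G (0, y)) := by
  rw [← setIntegral_stdTriangle_swap, setIntegral_stdTriangle_deriv_snd
    (g := fun z => g z.swap) (G := fun z => G z.swap) (by fun_prop) (fun x y => hG y x)]
  rfl

/-- Perimeter of a triangle. -/
def perimeter (p q r : Plane) : ℝ := dist p q + dist q r + dist p r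

/-- Incenter of a triangle: barycentric coordinates are proportional to the opposite sides. -/
def incenter (p q r : Plane) : Plane :=
  param p q r (dist p r / perimeter p q r, dist p q / perimeter p q r)

/-- Inradius of a triangle. -/
def inradius (p q r : Plane) : ℝ := |cross (q - p) (r - p)| / perimeter p q r

variable {p q r : Plane}

lemma perimeter_pos (h : cross (q - p) (r - p) ≠ 0) : 0 < perimeter p q r := by
  have : p ≠ q := by
    rintro rfl
    simp [cross] at h
  have := dist_pos.2 this
  unfold perimeter
  positivity

lemma inradius_pos (h : cross (q - p) (r - p) ≠ 0) : 0 < inradius p q r :=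
  div_pos (abs_pos.2 h) (perimeter_pos h)

lemma continuous_gradient {f : Plane → ℝ} (hf : ContDiff ℝ 1 f) : Continuous (∇ f) := by
  unfold gradient
  exact (LinearIsometryEquiv.continuous _).comp (hf.continuous_fderiv one_ne_zero)

/-- The divergence theorem on a triangle for the vector field `v (x - I)`, `I` the incenter: the
normal component of `x - I` is the inradius on all of the boundary. -/
theorem integral_div_incenter (h : cross (q - p) (r - p) ≠ 0) {v : Plane → ℝ}
    (hv : ContDiff ℝ 1 v) :
    ∫ x in triangle p q r, (inner ℝ (∇ v x) (x - incenter p q r) + 2 * v x) =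
      inradius p q r * ∫ x, v x ∂(boundaryMeasure (triangle p q r)) := by
  have hP := perimeter_pos h
  set P := perimeter p q r with hPdef
  set i := dist p r / P with hi
  set j := dist p q / P with hj
  -- The third barycentric coordinate of the incenter. It will be the weight of the side `q r`.
  have hij : 1 - i - j = dist q r / P := by
    rw [hi, hj]; field_simp; rw [hPdef, perimeter]; ring
  set F : ℝ × ℝ → ℝ := fun z => v (param p q r z) with hF
  have hFc : Continuous F := hv.continuous.comp (continuous_param p q r)
  have hdv : ∀ x, HasFDerivAt v (fderiv ℝ v x) x := fun x =>
    (hv.differentiable one_ne_zero x).hasFDerivAt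
  have hfc : Continuous (fderiv ℝ v) := hv.continuous_fderiv one_ne_zero
  have hpc := continuous_param p q r
  have hF1 : ∀ x y, HasDerivAt (fun t => F (t, y)) (fderiv ℝ v (param p q r (x, y)) (q - p)) x := by
    intro x y
    have hp : HasDerivAt (fun t => param p q r (t, y)) (q - p) x := by
      have := (((hasDerivAt_id x).smul_const (q - p)).const_add p).add_const (y • (r - p))
      simpa [param] using this
    exact (hdv (param p q r (x, y))).comp_hasDerivAt x hp
  have hF2 : ∀ x y, HasDerivAt (fun t => F (x, t)) (fderiv ℝ v (param p q r (x, y)) (r - p)) y := by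
    intro x y
    have hp : HasDerivAt (fun t => param p q r (x, t)) (r - p) y := by
      have := ((hasDerivAt_id y).smul_const (r - p)).const_add (p + x • (q - p))
      simpa [param] using this
    exact (hdv (param p q r (x, y))).comp_hasDerivAt y hp
  set g1 : ℝ × ℝ → ℝ := fun z => F z + (z.1 - i) * fderiv ℝ v (param p q r z) (q - p) with hg1
  set g2 : ℝ × ℝ → ℝ := fun z => F z + (z.2 - j) * fderiv ℝ v (param p q r z) (r - p) with hg2
  have hg1c : Continuous g1 := by fun_prop
  have hg2c : Continuous g2 := by fun_prop
  have I1 := setIntegral_stdTriangle_deriv_fst (g := g1) (G := fun z => (z.1 - i) * F z) hg1c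
    (fun x y => by
      have := ((hasDerivAt_id x).sub_const i).fun_mul (hF1 x y)
      simpa [hg1] using this)
  have I2 := setIntegral_stdTriangle_deriv_snd (g := g2) (G := fun z => (z.2 - j) * F z) hg2c
    (fun x y => by
      have := ((hasDerivAt_id y).sub_const j).fun_mul (hF2 x y)
      simpa [hg2] using this)
  -- In affine coordinates `x - I` has components `z.1 - i` and `z.2 - j`, so the divergence of `v
  -- (x - I)` is a sum of two coordinate derivatives, each integrated by the fundamental theorem.
  have hsum : ∀ z, inner ℝ (∇ v (param p q r z)) (param p q r z - incenter p q r) +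
      2 * v (param p q r z) = g1 z + g2 z := by
    intro z
    rw [inner_gradient_left]
    have : param p q r z - incenter p q r = (z.1 - i) • (q - p) + (z.2 - j) • (r - p) := by
      simp only [incenter, param, ← hPdef, ← hi, ← hj]
      module
    rw [this, map_add, map_smul, map_smul]
    simp only [hg1, hg2, hF, smul_eq_mul]
    ring
  rw [setIntegral_triangle h, integral_boundary_triangle h hv.continuous]
  simp only [hsum]
  rw [integral_add (integrableOn_stdTriangle hg1c) (integrableOn_stdTriangle hg2c), I1, I2]
  have c1 : Continuous fun t : ℝ => F (1 - t, t) := by fun_prop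
  have c2 : Continuous fun t : ℝ => F (t, 1 - t) := by fun_prop
  have c3 : Continuous fun t : ℝ => F (0, t) := by fun_prop
  have c4 : Continuous fun t : ℝ => F (t, 0) := by fun_prop
  have hrefl : ∫ x in (0 : ℝ)..1, (1 - x - j) * F (x, 1 - x) =
      ∫ y in (0 : ℝ)..1, (y - j) * F (1 - y, y) := by
    have := intervalIntegral.integral_comp_sub_left (a := 0) (b := 1)
      (fun y => (y - j) * F (1 - y, y)) (1 : ℝ)
    simpa using this
  have e1 : ∫ y in (0 : ℝ)..1, ((1 - y - i) * F (1 - y, y) - (0 - i) * F (0, y)) =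
      (∫ y in (0 : ℝ)..1, (1 - y - i) * F (1 - y, y)) + i * ∫ y in (0 : ℝ)..1, F (0, y) := by
    rw [intervalIntegral.integral_sub (Continuous.intervalIntegrable (by fun_prop) _ _)
      (Continuous.intervalIntegrable (by fun_prop) _ _), intervalIntegral.integral_const_mul]
    ring
  have e2 : ∫ x in (0 : ℝ)..1, ((1 - x - j) * F (x, 1 - x) - (0 - j) * F (x, 0)) =
      (∫ y in (0 : ℝ)..1, (y - j) * F (1 - y, y)) + j * ∫ y in (0 : ℝ)..1, F (y, 0) := by
    rw [intervalIntegral.integral_sub (Continuous.intervalIntegrable (by fun_prop) _ _)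
      (Continuous.intervalIntegrable (by fun_prop) _ _), intervalIntegral.integral_const_mul, hrefl]
    ring
  -- On the hypotenuse the two fluxes add up to a constant weight: `(1 - y - i) + (y - j) = 1 - i -
  -- j`.
  have e3 : (∫ y in (0 : ℝ)..1, (1 - y - i) * F (1 - y, y)) +
      (∫ y in (0 : ℝ)..1, (y - j) * F (1 - y, y)) =
      (1 - i - j) * ∫ y in (0 : ℝ)..1, F (1 - y, y) := by
    rw [← intervalIntegral.integral_add (Continuous.intervalIntegrable (by fun_prop) _ _)
      (Continuous.intervalIntegrable (by fun_prop) _ _), ← intervalIntegral.integral_const_mul]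
    congr 1
    funext y
    ring
  simp only at e1 e2 ⊢
  rw [e1, e2]
  have e4 : ∀ a b c d : ℝ, a + b + (c + d) = (a + c) + b + d := fun a b c d => by ring
  rw [e4, e3, hij, inradius, ← hPdef, hi, hj, smul_eq_mul]
  simp only [hF]
  field_simp
  ring

lemma integrableOn_triangle (p q r : Plane) {E : Type*} [NormedAddCommGroup E]
    {g : Plane → E} (hg : Continuous g) : IntegrableOn g (triangle p q r) :=
  (hg.continuousOn.integrableOn_compact
    (Metric.isCompact_of_isClosed_isBounded isClosed_closure
      (isBounded_triangle p q r).closure)).mono_set subset_closure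

/-- The trace inequality on a triangle. -/
theorem exists_trace_inequality (h : cross (q - p) (r - p) ≠ 0) :
    ∃ C : ℝ, 0 < C ∧ ∀ v : Plane → ℝ, ContDiff ℝ 1 v →
      ∫ x, v x ^ 2 ∂(boundaryMeasure (triangle p q r)) ≤
        C * ((∫ x in triangle p q r, v x ^ 2) + ∫ x in triangle p q r, ‖∇ v x‖ ^ 2) := by
  obtain ⟨d, hd⟩ := (isBounded_triangle p q r).subset_closedBall (incenter p q r)
  have hr := inradius_pos h
  -- Apply the divergence identity to `v²`. The cross term is bounded by `2 |v| d |∇v| ≤ v² + d²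
  -- |∇v|²`, and the divergence of `x - I` adds `2 v²`.
  refine ⟨(3 + d ^ 2) / inradius p q r, by positivity, fun v hv => ?_⟩
  have hg := continuous_gradient hv
  have hv2 := hv.continuous
  have key := integral_div_incenter h (v := fun x => v x ^ 2) (hv.pow 2)
  have hgrad : ∀ x, ∇ (fun x => v x ^ 2) x = (2 * v x) • ∇ v x := by
    intro x
    have := ((hv.differentiable one_ne_zero x).hasFDerivAt).pow 2
    simp only [gradient]
    rw [this.fderiv]
    simp
  have hle : ∫ x in triangle p q r,
      (inner ℝ (∇ (fun x => v x ^ 2) x) (x - incenter p q r) + 2 * v x ^ 2) ≤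
      ∫ x in triangle p q r, (3 * v x ^ 2 + d ^ 2 * ‖∇ v x‖ ^ 2) := by
    refine setIntegral_mono_on (integrableOn_triangle p q r ?_)
      (integrableOn_triangle p q r (by fun_prop)) (isOpen_triangle p q r).measurableSet ?_
    · simp only [hgrad]; fun_prop
    · intro x hx
      have hx' := hd hx
      rw [Metric.mem_closedBall, dist_eq_norm] at hx'
      rw [hgrad, real_inner_smul_left]
      have h1 : |inner ℝ (∇ v x) (x - incenter p q r)| ≤ ‖∇ v x‖ * d :=
        (abs_real_inner_le_norm _ _).trans (by gcongr)
      have h2 : inner ℝ (∇ v x) (x - incenter p q r) ^ 2 ≤ (‖∇ v x‖ * d) ^ 2 :=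
        sq_le_sq' (by linarith [(abs_le.1 h1).1]) (abs_le.1 h1).2
      nlinarith [sq_nonneg (v x - inner ℝ (∇ v x) (x - incenter p q r))]
  rw [key] at hle
  rw [integral_add (integrableOn_triangle p q r (by fun_prop))
    (integrableOn_triangle p q r (by fun_prop)), integral_const_mul, integral_const_mul] at hle
  have n1 : 0 ≤ ∫ x in triangle p q r, v x ^ 2 := integral_nonneg fun x => sq_nonneg _
  have n2 : 0 ≤ ∫ x in triangle p q r, ‖∇ v x‖ ^ 2 := integral_nonneg fun x => sq_nonneg _
  rw [div_mul_eq_mul_div, le_div_iff₀ hr]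
  nlinarith [mul_nonneg (sq_nonneg d) n1]

end Gauss

/-! ### Poincaré inequality on bounded convex open sets, by integration along segments. -/

section Poincare

variable {Ω : Set Plane}

/-- By convexity `y ↦ (1 - t) x + t y` maps `Ω` into itself, and for `t ≥ 1/2` the Jacobian of the
inverse is `t⁻² ≤ 4`. -/
lemma setLIntegral_lineMap_le (hm : MeasurableSet Ω) (hc : Convex ℝ Ω) {h : Plane → ENNReal}
    (hh : Measurable h) {x : Plane} (hx : x ∈ Ω) {t : ℝ} (ht : t ∈ Icc (1 / 2 : ℝ) 1) :
    ∫⁻ y in Ω, h (AffineMap.lineMap x y t) ≤ 4 * ∫⁻ y in Ω, h y := by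
  have ht0 : 0 < t := by linarith [ht.1]
  have hL : ∀ y : Plane, AffineMap.lineMap x y t = (1 - t) • x + t • y := fun y => by
    rw [AffineMap.lineMap_apply_module]
  have hmap : (volume : Measure Plane).map (fun y => (1 - t) • x + t • y) =
      ENNReal.ofReal |(t ^ 2)⁻¹| • volume := by
    have : (fun y : Plane => (1 - t) • x + t • y) =
        (fun y => (1 - t) • x + y) ∘ (fun y => t • y) := rfl
    rw [this, ← Measure.map_map (measurable_const_add _) (measurable_const_smul t),
      Measure.map_addHaar_smul _ ht0.ne', Measure.map_smul, map_add_left_eq_self]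
    simp
  have hmeas : Measurable fun y : Plane => (1 - t) • x + t • y := by fun_prop
  calc ∫⁻ y in Ω, h (AffineMap.lineMap x y t)
      ≤ ∫⁻ y, Ω.indicator h ((1 - t) • x + t • y) := by
        rw [← lintegral_indicator hm]
        refine lintegral_mono fun y => ?_
        by_cases hy : y ∈ Ω
        · have : (1 - t) • x + t • y ∈ Ω :=
            hc hx hy (by linarith [ht.2]) ht0.le (by ring)
          rw [indicator_of_mem hy, indicator_of_mem this, hL]
        · rw [indicator_of_notMem hy]; exact zero_le
    _ = ENNReal.ofReal |(t ^ 2)⁻¹| * ∫⁻ y in Ω, h y := by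
        rw [← lintegral_map (hh.indicator hm) hmeas, hmap, lintegral_smul_measure,
          lintegral_indicator hm, smul_eq_mul]
    _ ≤ 4 * ∫⁻ y in Ω, h y := by
        gcongr
        rw [show (4 : ENNReal) = ENNReal.ofReal 4 by norm_num]
        refine ENNReal.ofReal_le_ofReal ?_
        rw [abs_of_pos (by positivity)]
        rw [inv_le_comm₀ (by positivity) (by norm_num)]
        nlinarith [ht.1]

lemma sq_intervalIntegral_le {g : ℝ → ℝ} (hg : Continuous g) :
    (∫ t in (0 : ℝ)..1, g t) ^ 2 ≤ ∫ t in (0 : ℝ)..1, g t ^ 2 := by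
  set m := ∫ t in (0 : ℝ)..1, g t with hm
  have h0 : 0 ≤ ∫ t in (0 : ℝ)..1, (g t - m) ^ 2 :=
    intervalIntegral.integral_nonneg zero_le_one fun t _ => sq_nonneg _
  have h1 : ∫ t in (0 : ℝ)..1, (g t - m) ^ 2 =
      (∫ t in (0 : ℝ)..1, g t ^ 2) - 2 * m * (∫ t in (0 : ℝ)..1, g t) + m ^ 2 := by
    have : ∀ t, (g t - m) ^ 2 = g t ^ 2 - 2 * m * g t + m ^ 2 := fun t => by ring
    simp only [this]
    rw [intervalIntegral.integral_add (Continuous.intervalIntegrable (by fun_prop) _ _)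
      (Continuous.intervalIntegrable (by fun_prop) _ _),
      intervalIntegral.integral_sub (Continuous.intervalIntegrable (by fun_prop) _ _)
      (Continuous.intervalIntegrable (by fun_prop) _ _), intervalIntegral.integral_const_mul]
    simp
  rw [h1, ← hm] at h0
  nlinarith

/-- The fundamental theorem along the segment from `x` to `y`, followed by Cauchy–Schwarz. The
`ENNReal` form prepares for Tonelli. -/
lemma sq_sub_le_lintegral {v : Plane → ℝ} (hv : ContDiff ℝ 1 v) {d : ℝ} {x y : Plane}
    (hxy : dist x y ≤ d) :
    ENNReal.ofReal ((v x - v y) ^ 2) ≤ ENNReal.ofReal (d ^ 2) *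
      ∫⁻ t in Icc (0 : ℝ) 1, ENNReal.ofReal (‖∇ v (AffineMap.lineMap x y t)‖ ^ 2) := by
  have hg := continuous_gradient hv
  have hl : Continuous fun t : ℝ => AffineMap.lineMap x y t :=
    AffineMap.lineMap_continuous (R := ℝ)
  have hder : ∀ t : ℝ, HasDerivAt (fun t : ℝ => v (AffineMap.lineMap x y t))
      (inner ℝ (∇ v (AffineMap.lineMap x y t)) (y - x)) t := by
    intro t
    have h1 := (hv.differentiable one_ne_zero (AffineMap.lineMap x y t)).hasFDerivAt
    have h2 : HasDerivAt (fun t : ℝ => AffineMap.lineMap x y t) (y - x) t :=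
      AffineMap.hasDerivAt_lineMap
    rw [inner_gradient_left]
    exact h1.comp_hasDerivAt t h2
  have hint : ∫ t in (0 : ℝ)..1, inner ℝ (∇ v (AffineMap.lineMap x y t)) (y - x) = v y - v x := by
    rw [intervalIntegral.integral_eq_sub_of_hasDerivAt (fun t _ => hder t)
      (Continuous.intervalIntegrable (by fun_prop) _ _)]
    simp
  have hd0 : 0 ≤ d := dist_nonneg.trans hxy
  have hreal : (v x - v y) ^ 2 ≤ d ^ 2 * ∫ t in Icc (0 : ℝ) 1,
      ‖∇ v (AffineMap.lineMap x y t)‖ ^ 2 := by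
    calc (v x - v y) ^ 2 = (v y - v x) ^ 2 := by ring
      _ ≤ ∫ t in (0 : ℝ)..1, inner ℝ (∇ v (AffineMap.lineMap x y t)) (y - x) ^ 2 := by
        rw [← hint]; exact sq_intervalIntegral_le (by fun_prop)
      _ ≤ ∫ t in (0 : ℝ)..1, d ^ 2 * ‖∇ v (AffineMap.lineMap x y t)‖ ^ 2 := by
        refine intervalIntegral.integral_mono_on zero_le_one
          (Continuous.intervalIntegrable (by fun_prop) _ _)
          (Continuous.intervalIntegrable (by fun_prop) _ _) fun t _ => ?_
        rw [← mul_pow, ← sq_abs]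
        refine pow_le_pow_left₀ (abs_nonneg _) ((abs_real_inner_le_norm _ _).trans ?_) 2
        rw [mul_comm]
        gcongr
        rwa [← dist_eq_norm, dist_comm]
      _ = _ := by
        rw [intervalIntegral.integral_const_mul, intervalIntegral.integral_of_le zero_le_one,
          integral_Icc_eq_integral_Ioc]
  calc ENNReal.ofReal ((v x - v y) ^ 2) ≤ ENNReal.ofReal (d ^ 2 * ∫ t in Icc (0 : ℝ) 1,
      ‖∇ v (AffineMap.lineMap x y t)‖ ^ 2) := ENNReal.ofReal_le_ofReal hreal
    _ = _ := by
      rw [ENNReal.ofReal_mul (sq_nonneg d), ofReal_integral_eq_lintegral_ofReal]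
      · exact Continuous.integrableOn_Icc (by fun_prop)
      · exact ae_of_all _ fun t => sq_nonneg _

/-- The change of variables in `y` degenerates as `t → 0`. For `t ≤ 1/2` the roles of `x` and `y`
are exchanged, so the factor `4` holds for all `t`. -/
lemma lintegral_lintegral_lineMap_le (hm : MeasurableSet Ω) (hc : Convex ℝ Ω)
    {h : Plane → ENNReal} (hh : Measurable h) {t : ℝ} (ht : t ∈ Icc (0 : ℝ) 1) :
    ∫⁻ x in Ω, ∫⁻ y in Ω, h (AffineMap.lineMap x y t) ≤
      4 * (∫⁻ y in Ω, h y) * volume Ω := by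
  have hcont : Continuous fun z : Plane × Plane => AffineMap.lineMap z.1 z.2 t := by
    simp only [AffineMap.lineMap_apply_module]; fun_prop
  rcases le_total (1 / 2 : ℝ) t with h2 | h2
  · calc ∫⁻ x in Ω, ∫⁻ y in Ω, h (AffineMap.lineMap x y t)
        ≤ ∫⁻ x in Ω, 4 * ∫⁻ y in Ω, h y :=
          setLIntegral_mono' hm fun x hx => setLIntegral_lineMap_le hm hc hh hx ⟨h2, ht.2⟩
      _ = _ := by simp
  · rw [lintegral_lintegral_swap (f := fun x y => h (AffineMap.lineMap x y t))
      (hh.comp hcont.measurable).aemeasurable]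
    calc ∫⁻ y in Ω, ∫⁻ x in Ω, h (AffineMap.lineMap x y t)
        ≤ ∫⁻ x in Ω, 4 * ∫⁻ y in Ω, h y := by
          refine setLIntegral_mono' hm fun y hy => ?_
          have := setLIntegral_lineMap_le hm hc hh hy (t := 1 - t)
            ⟨by linarith, by linarith [ht.1]⟩
          simpa only [AffineMap.lineMap_apply_one_sub] using this
      _ = _ := by simp

lemma measurable_lineMap : Measurable fun z : (Plane × Plane) × ℝ =>
    AffineMap.lineMap z.1.1 z.1.2 z.2 := by
  simp only [AffineMap.lineMap_apply_module]
  exact Continuous.measurable (by fun_prop)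

lemma lintegral_lintegral_segment_le (hm : MeasurableSet Ω) (hc : Convex ℝ Ω)
    {h : Plane → ENNReal} (hh : Measurable h) :
    ∫⁻ x in Ω, ∫⁻ y in Ω, ∫⁻ t in Icc (0 : ℝ) 1, h (AffineMap.lineMap x y t) ≤
      4 * (∫⁻ x in Ω, h x) * volume Ω := by
  have hF : Measurable fun z : (Plane × Plane) × ℝ => h (AffineMap.lineMap z.1.1 z.1.2 z.2) :=
    hh.comp measurable_lineMap
  have h1 : ∀ x : Plane, ∫⁻ y in Ω, ∫⁻ t in Icc (0 : ℝ) 1, h (AffineMap.lineMap x y t) =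
      ∫⁻ t in Icc (0 : ℝ) 1, ∫⁻ y in Ω, h (AffineMap.lineMap x y t) := by
    intro x
    have : Measurable (Function.uncurry fun (y : Plane) (t : ℝ) => h (AffineMap.lineMap x y t)) :=
      hF.comp (f := fun z : Plane × ℝ => ((x, z.1), z.2)) (by fun_prop)
    exact lintegral_lintegral_swap this.aemeasurable
  have h2 : ∫⁻ x in Ω, ∫⁻ t in Icc (0 : ℝ) 1, ∫⁻ y in Ω, h (AffineMap.lineMap x y t) =
      ∫⁻ t in Icc (0 : ℝ) 1, ∫⁻ x in Ω, ∫⁻ y in Ω, h (AffineMap.lineMap x y t) := by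
    have h3 : Measurable fun z : (Plane × ℝ) × Plane => h (AffineMap.lineMap z.1.1 z.2 z.1.2) :=
      hF.comp (f := fun z : (Plane × ℝ) × Plane => ((z.1.1, z.2), z.1.2)) (by fun_prop)
    have h4 : Measurable (Function.uncurry fun (x : Plane) (t : ℝ) =>
        ∫⁻ y in Ω, h (AffineMap.lineMap x y t)) :=
      h3.lintegral_prod_right'
    exact lintegral_lintegral_swap h4.aemeasurable
  simp_rw [h1]
  rw [h2]
  calc ∫⁻ t in Icc (0 : ℝ) 1, ∫⁻ x in Ω, ∫⁻ y in Ω, h (AffineMap.lineMap x y t)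
      ≤ ∫⁻ t in Icc (0 : ℝ) 1, 4 * (∫⁻ x in Ω, h x) * volume Ω :=
        setLIntegral_mono' measurableSet_Icc fun t ht =>
          lintegral_lintegral_lineMap_le hm hc hh ht
    _ = _ := by simp

lemma lintegral_lintegral_sq_sub_le (hm : MeasurableSet Ω) (hc : Convex ℝ Ω) {d : ℝ}
    (hd : ∀ ⦃x⦄, x ∈ Ω → ∀ ⦃y⦄, y ∈ Ω → dist x y ≤ d) {v : Plane → ℝ} (hv : ContDiff ℝ 1 v) :
    ∫⁻ x in Ω, ∫⁻ y in Ω, ENNReal.ofReal ((v x - v y) ^ 2) ≤ ENNReal.ofReal (d ^ 2) *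
      (4 * (∫⁻ x in Ω, ENNReal.ofReal (‖∇ v x‖ ^ 2)) * volume Ω) := by
  have hg := continuous_gradient hv
  have hhm : Measurable fun x => ENNReal.ofReal (‖∇ v x‖ ^ 2) :=
    (ENNReal.continuous_ofReal.comp (by fun_prop : Continuous fun x => ‖∇ v x‖ ^ 2)).measurable
  have h1 : ∫⁻ x in Ω, ∫⁻ y in Ω, ENNReal.ofReal ((v x - v y) ^ 2) ≤
      ∫⁻ x in Ω, ∫⁻ y in Ω, ENNReal.ofReal (d ^ 2) *
        ∫⁻ t in Icc (0 : ℝ) 1, ENNReal.ofReal (‖∇ v (AffineMap.lineMap x y t)‖ ^ 2) :=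
    setLIntegral_mono' hm fun x hx => setLIntegral_mono' hm fun y hy =>
      sq_sub_le_lintegral hv (hd hx hy)
  refine h1.trans ?_
  simp_rw [lintegral_const_mul' _ _ (ENNReal.ofReal_ne_top (r := d ^ 2))]
  gcongr
  exact lintegral_lintegral_segment_le hm hc hhm

/-- The variance as a double integral of squared differences; this links the segment estimate to the
Poincaré inequality. -/
lemma integral_prod_sq_sub {X : Type*} [MeasurableSpace X] {μ : Measure X} [IsFiniteMeasure μ]
    {v : X → ℝ} (h1 : Integrable v μ) (h2 : Integrable (fun x => v x ^ 2) μ) :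
    Integrable (fun z : X × X => (v z.1 - v z.2) ^ 2) (μ.prod μ) ∧
    ∫ z, (v z.1 - v z.2) ^ 2 ∂(μ.prod μ) =
      2 * (μ.real univ * (∫ x, v x ^ 2 ∂μ) - (∫ x, v x ∂μ) ^ 2) := by
  have hexp : ∀ z : X × X, (v z.1 - v z.2) ^ 2 =
      v z.1 ^ 2 * 1 - 2 * (v z.1 * v z.2) + 1 * v z.2 ^ 2 := fun z => by ring
  have i1 : Integrable (fun z : X × X => v z.1 ^ 2 * 1) (μ.prod μ) :=
    h2.mul_prod (integrable_const (1 : ℝ))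
  have i2 : Integrable (fun z : X × X => v z.1 * v z.2) (μ.prod μ) := h1.mul_prod h1
  have i3 : Integrable (fun z : X × X => 1 * v z.2 ^ 2) (μ.prod μ) :=
    (integrable_const (1 : ℝ)).mul_prod h2
  simp only [hexp]
  refine ⟨(i1.sub (i2.const_mul 2)).add i3, ?_⟩
  rw [integral_add (f := fun z : X × X => v z.1 ^ 2 * 1 - 2 * (v z.1 * v z.2))
      (i1.sub (i2.const_mul 2)) i3, integral_sub i1 (i2.const_mul 2),
    integral_const_mul, integral_prod_mul (fun x => v x ^ 2) (fun _ => (1 : ℝ)),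
    integral_prod_mul v v, integral_prod_mul (fun _ => (1 : ℝ)) (fun x => v x ^ 2)]
  simp
  ring

/-- The Poincaré inequality on a bounded convex open set of the plane. -/
theorem exists_poincare_inequality (ho : IsOpen Ω) (hc : Convex ℝ Ω)
    (hb : Bornology.IsBounded Ω) :
    ∃ C : ℝ, 0 < C ∧ ∀ v : Plane → ℝ, ContDiff ℝ 1 v →
      volume.real Ω * (∫ x in Ω, v x ^ 2) - (∫ x in Ω, v x) ^ 2 ≤ C * ∫ x in Ω, ‖∇ v x‖ ^ 2 := by
  have hm := ho.measurableSet
  obtain ⟨d, hd⟩ := Metric.isBounded_iff.1 hb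
  have hfin : volume Ω ≠ ⊤ := hb.measure_lt_top.ne
  have : IsFiniteMeasure (volume.restrict Ω) := ⟨by simpa using hb.measure_lt_top⟩
  have hcomp : IsCompact (closure Ω) :=
    Metric.isCompact_of_isClosed_isBounded isClosed_closure hb.closure
  -- The estimate gives `2 d² |Ω|`; the added `1` only secures positivity of the constant.
  refine ⟨2 * d ^ 2 * volume.real Ω + 1, by positivity, fun v hv => ?_⟩
  have hint : ∀ {g : Plane → ℝ}, Continuous g → Integrable g (volume.restrict Ω) := fun hg =>
    (hg.continuousOn.integrableOn_compact hcomp).mono_set subset_closure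
  have hvc := hv.continuous
  have hg := continuous_gradient hv
  set G := ∫ x in Ω, ‖∇ v x‖ ^ 2 with hG
  have hG0 : 0 ≤ G := integral_nonneg fun x => sq_nonneg _
  have hGl : ∫⁻ x in Ω, ENNReal.ofReal (‖∇ v x‖ ^ 2) = ENNReal.ofReal G := by
    rw [hG, ofReal_integral_eq_lintegral_ofReal (hint (by fun_prop))
      (ae_of_all _ fun x => sq_nonneg _)]
  have hmain := lintegral_lintegral_sq_sub_le hm hc hd hv
  obtain ⟨hi, hprod⟩ := integral_prod_sq_sub (hint hvc)
    (hint (g := fun x => v x ^ 2) (by fun_prop))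
  have hle : ENNReal.ofReal (∫ z, (v z.1 - v z.2) ^ 2
      ∂((volume.restrict Ω).prod (volume.restrict Ω))) ≤
      ENNReal.ofReal (d ^ 2 * (4 * G * volume.real Ω)) := by
    rw [ofReal_integral_eq_lintegral_ofReal hi (ae_of_all _ fun z => sq_nonneg _),
      lintegral_prod _ hi.aestronglyMeasurable.aemeasurable.ennreal_ofReal]
    refine hmain.trans (le_of_eq ?_)
    rw [hGl, ENNReal.ofReal_mul (sq_nonneg d), ENNReal.ofReal_mul (by positivity),
      ENNReal.ofReal_mul (by norm_num), measureReal_def, ENNReal.ofReal_toReal hfin]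
    norm_num
  rw [ENNReal.ofReal_le_ofReal_iff (by positivity), hprod] at hle
  simp only [measureReal_restrict_apply_univ] at hle
  nlinarith

end Poincare

/-! ### The Hilbert space `H¹(Ω)`, its bilinear forms, and density of smooth functions. -/

section Sobolev

variable {Ω : Set Plane}

lemma hasCompactSupport_gradient {η : Plane → ℝ} (hc : HasCompactSupport η) :
    HasCompactSupport (∇ η) :=
  (hc.fderiv (𝕜 := ℝ)).comp_left (g := (InnerProductSpace.toDual ℝ Plane).symm) (map_zero _)

/-- Integration by parts against a compactly supported function. -/
lemma integral_smul_gradient_eq {f η : Plane → ℝ} (hf : ContDiff ℝ ∞ f) (hη : ContDiff ℝ ∞ η)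
    (hc : HasCompactSupport η) : ∫ x, f x • ∇ η x = - ∫ x, η x • ∇ f x := by
  have hf1 : ContDiff ℝ 1 f := hf.of_le (by simp)
  have hη1 : ContDiff ℝ 1 η := hη.of_le (by simp)
  have cf := continuous_gradient hf1
  have ch := continuous_gradient hη1
  have s1 : HasCompactSupport (fun x => f x • ∇ η x) :=
    (hasCompactSupport_gradient hc).mono fun x hx => by
      rw [Function.mem_support] at hx ⊢
      exact fun h0 => hx (by rw [h0, smul_zero])
  have s2 : HasCompactSupport (fun x => η x • ∇ f x) := hc.smul_right
  have i1 : Integrable (fun x => f x • ∇ η x) :=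
    (Continuous.smul hf.continuous ch).integrable_of_hasCompactSupport s1
  have i2 : Integrable (fun x => η x • ∇ f x) :=
    (Continuous.smul hη.continuous cf).integrable_of_hasCompactSupport s2
  have key : ∀ (u v : Plane → ℝ) (c x : Plane), inner ℝ c (u x • ∇ v x) = u x * fderiv ℝ v x c := by
    intro u v c x
    rw [real_inner_smul_right, real_inner_comm, inner_gradient_left]
  refine ext_inner_left ℝ fun c => ?_
  have j1 := i1.const_inner (𝕜 := ℝ) c
  have j2 := i2.const_inner (𝕜 := ℝ) c
  rw [inner_neg_right, ← integral_inner i1 c, ← integral_inner i2 c]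
  simp only [key] at j1 j2 ⊢
  have j3 : Integrable (fun x => f x * η x) :=
    Continuous.integrable_of_hasCompactSupport (hf.continuous.mul hη.continuous) hc.mul_left
  simp only [mul_comm (η _)] at j2 ⊢
  exact integral_mul_fderiv_eq_neg_fderiv_mul_of_integrable (μ := (volume : Measure Plane))
    j2 j1 j3
    (fun x _ => hf1.differentiable one_ne_zero x) (fun x _ => hη1.differentiable one_ne_zero x)

lemma smoothGraph_le_weakGradientGraph : smoothGraph Ω ≤ weakGradientGraph Ω := by
  rintro w ⟨f, hf, h1, h2, -⟩ η hη hc hs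
  have e1 : ∫ x in Ω, w.fst x • ∇ η x = ∫ x in Ω, f x • ∇ η x := by
    refine integral_congr_ae ?_
    filter_upwards [h1] with x hx
    rw [hx]
  have e2 : ∫ x in Ω, η x • w.snd.fst x = ∫ x in Ω, η x • ∇ f x := by
    refine integral_congr_ae ?_
    filter_upwards [h2] with x hx
    rw [hx]
  have z : ∀ x, x ∉ Ω → η x = 0 := fun x hx => image_eq_zero_of_notMem_tsupport fun h => hx (hs h)
  have z' : ∀ x, x ∉ Ω → ∇ η x = 0 := fun x hx => by
    have : x ∉ tsupport (fderiv ℝ η) := fun h => hx (hs (tsupport_fderiv_subset ℝ h))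
    simp [gradient, image_eq_zero_of_notMem_tsupport this]
  rw [e1, e2,
    setIntegral_eq_integral_of_forall_compl_eq_zero (fun x hx => by rw [z' x hx, smul_zero]),
    setIntegral_eq_integral_of_forall_compl_eq_zero (fun x hx => by rw [z x hx, zero_smul])]
  exact integral_smul_gradient_eq hf hη hc

lemma smoothGraph_le_H1 : smoothGraph Ω ≤ H1 Ω :=
  le_inf smoothGraph_le_weakGradientGraph (Submodule.le_topologicalClosure _)

/-- For a fixed test function and a fixed direction `c`, integration by parts equates two `L²`
pairings, both continuous in the triple. The graph is an intersection of such closed conditions. -/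
lemma isClosed_weakGradientGraph : IsClosed (weakGradientGraph Ω : Set (Triple Ω)) := by
  have hset : (weakGradientGraph Ω : Set (Triple Ω)) = ⋂ (η : Plane → ℝ) (_ : ContDiff ℝ ∞ η)
      (_ : HasCompactSupport η) (_ : tsupport η ⊆ Ω) (c : Plane),
      {w : Triple Ω | ∫ x in Ω, inner ℝ (inner ℝ c (∇ η x)) (w.fst x) =
        - ∫ x in Ω, inner ℝ (η x • c) (w.snd.fst x)} := by
    ext w
    simp only [mem_iInter]
    refine forall₄_congr fun η hη hc hs => ?_
    have k : ∀ c : Plane, (w ∈ {w : Triple Ω | ∫ x in Ω, inner ℝ (inner ℝ c (∇ η x)) (w.fst x) =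
        - ∫ x in Ω, inner ℝ (η x • c) (w.snd.fst x)}) ↔
        inner ℝ c (∫ x in Ω, w.fst x • ∇ η x) =
        inner ℝ c (- ∫ x in Ω, η x • w.snd.fst x) := by
      intro c
      rw [inner_neg_right, ← integral_inner (integrable_smul_gradient _ hη hc) c,
        ← integral_inner (integrable_smul_vector _ hη hc) c]
      simp [real_inner_smul_left, real_inner_smul_right]
    simp only [k]
    exact ⟨fun h c => by rw [h], fun h => ext_inner_left ℝ h⟩
  rw [hset]
  refine isClosed_iInter fun η => isClosed_iInter fun hη => isClosed_iInter fun hc =>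
    isClosed_iInter fun hs => isClosed_iInter fun c => ?_
  have hg := continuous_gradient (hη.of_le (by simp) : ContDiff ℝ 1 η)
  have m1 : MemLp (fun x => inner ℝ c (∇ η x)) 2 (interiorMeasure Ω) := by
    refine (Continuous.memLp_of_hasCompactSupport (μ := volume) (by fun_prop) ?_).restrict Ω
    exact (hasCompactSupport_gradient hc).comp_left (g := fun y => inner ℝ c y) (inner_zero_right c)
  have m2 : MemLp (fun x => η x • c) 2 (interiorMeasure Ω) := by
    refine (Continuous.memLp_of_hasCompactSupport (μ := volume)
      (hη.continuous.smul continuous_const) ?_).restrict Ω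
    exact hc.smul_right
  have e1 : ∀ w : Triple Ω, ∫ x in Ω, inner ℝ (inner ℝ c (∇ η x)) (w.fst x) =
      inner ℝ (m1.toLp _) w.fst := by
    intro w
    rw [L2.inner_def]
    refine integral_congr_ae ?_
    filter_upwards [m1.coeFn_toLp] with x hx
    rw [hx]
  have e2 : ∀ w : Triple Ω, ∫ x in Ω, inner ℝ (η x • c) (w.snd.fst x) =
      inner ℝ (m2.toLp _) w.snd.fst := by
    intro w
    rw [L2.inner_def]
    refine integral_congr_ae ?_
    filter_upwards [m2.coeFn_toLp] with x hx
    rw [hx]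
  simp only [e1, e2]
  have c1 : Continuous fun w : Triple Ω => w.fst := (WithLp.fstL 2 ℝ _ _).continuous
  have c2 : Continuous fun w : Triple Ω => w.snd.fst :=
    (WithLp.fstL 2 ℝ _ _).continuous.comp (WithLp.sndL 2 ℝ _ _).continuous
  exact isClosed_eq (continuous_const.inner c1) (continuous_const.inner c2).neg

instance : CompleteSpace (H1 Ω) :=
  IsClosed.completeSpace_coe (hs := isClosed_weakGradientGraph.inter
    (Submodule.isClosed_topologicalClosure _))

/-- The space `H¹(Ω)` with its Hilbert structure sealed, so that instances unify quickly. -/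
def Sobolev (Ω : Set Plane) : Type := H1 Ω

instance : NormedAddCommGroup (Sobolev Ω) := inferInstanceAs (NormedAddCommGroup (H1 Ω))

instance : InnerProductSpace ℝ (Sobolev Ω) := inferInstanceAs (InnerProductSpace ℝ (H1 Ω))

instance : CompleteSpace (Sobolev Ω) := inferInstanceAs (CompleteSpace (H1 Ω))

/-- The identity from the sealed space to `H¹(Ω)`. -/
def toH1L (Ω : Set Plane) : Sobolev Ω →L[ℝ] H1 Ω where
  toFun w := w
  map_add' _ _ := rfl
  map_smul' _ _ := rfl
  cont := continuous_id (X := H1 Ω)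

/-- `f` is a smooth function on the plane whose restriction to `Ω` is the Sobolev function `w`. -/
def IsSmoothRep (w : Sobolev Ω) (f : Plane → ℝ) : Prop :=
  ContDiff ℝ ∞ f ∧ val w =ᵐ[interiorMeasure Ω] f ∧ grad w =ᵐ[interiorMeasure Ω] ∇ f ∧
    trace w =ᵐ[boundaryMeasure Ω] f

lemma dense_isSmoothRep : Dense {w : Sobolev Ω | ∃ f, IsSmoothRep w f} := by
  change Dense {w : H1 Ω | ∃ f, IsSmoothRep w f}
  intro w
  rw [closure_subtype]
  have himg : Subtype.val '' {w : H1 Ω | ∃ f, IsSmoothRep w f} =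
      (smoothGraph Ω : Set (Triple Ω)) := by
    ext v
    constructor
    · rintro ⟨v, ⟨f, hf⟩, rfl⟩
      exact ⟨f, hf⟩
    · rintro ⟨f, hf⟩
      exact ⟨⟨v, smoothGraph_le_H1 ⟨f, hf⟩⟩, ⟨f, hf⟩, rfl⟩
  rw [himg]
  exact w.2.2

/-- The underlying function, as a continuous linear map. -/
def valL (Ω : Set Plane) : Sobolev Ω →L[ℝ] Lp ℝ 2 (interiorMeasure Ω) :=
  (WithLp.fstL 2 ℝ _ _).comp ((H1 Ω).subtypeL.comp (toH1L Ω))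

/-- The weak gradient, as a continuous linear map. -/
def gradL (Ω : Set Plane) : Sobolev Ω →L[ℝ] Lp Plane 2 (interiorMeasure Ω) :=
  (WithLp.fstL 2 ℝ _ _).comp ((WithLp.sndL 2 ℝ _ _).comp ((H1 Ω).subtypeL.comp (toH1L Ω)))

/-- The trace, as a continuous linear map. -/
def traceL (Ω : Set Plane) : Sobolev Ω →L[ℝ] Lp ℝ 2 (boundaryMeasure Ω) :=
  (WithLp.sndL 2 ℝ _ _).comp ((WithLp.sndL 2 ℝ _ _).comp ((H1 Ω).subtypeL.comp (toH1L Ω)))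

/-- The mass form as a continuous bilinear form. -/
def massForm (Ω : Set Plane) : Sobolev Ω →L[ℝ] Sobolev Ω →L[ℝ] ℝ :=
  (innerSL ℝ).bilinearComp (valL Ω) (valL Ω)

/-- The Dirichlet form as a continuous bilinear form. -/
def dirichletForm (Ω : Set Plane) : Sobolev Ω →L[ℝ] Sobolev Ω →L[ℝ] ℝ :=
  (innerSL ℝ).bilinearComp (gradL Ω) (gradL Ω)

/-- The boundary mass form as a continuous bilinear form. -/
def boundaryForm (Ω : Set Plane) : Sobolev Ω →L[ℝ] Sobolev Ω →L[ℝ] ℝ :=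
  (innerSL ℝ).bilinearComp (traceL Ω) (traceL Ω)

lemma massForm_eq_inner (w v : Sobolev Ω) : massForm Ω w v = inner ℝ (val w) (val v) := rfl

lemma dirichletForm_eq_inner (w v : Sobolev Ω) :
    dirichletForm Ω w v = inner ℝ (grad w) (grad v) := rfl

lemma boundaryForm_eq_inner (w v : Sobolev Ω) :
    boundaryForm Ω w v = inner ℝ (trace w) (trace v) := rfl

lemma massForm_comm (w v : Sobolev Ω) : massForm Ω w v = massForm Ω v w := by
  rw [massForm_eq_inner, massForm_eq_inner, real_inner_comm]

lemma dirichletForm_comm (w v : Sobolev Ω) : dirichletForm Ω w v = dirichletForm Ω v w := by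
  rw [dirichletForm_eq_inner, dirichletForm_eq_inner, real_inner_comm]

lemma boundaryForm_comm (w v : Sobolev Ω) : boundaryForm Ω w v = boundaryForm Ω v w := by
  rw [boundaryForm_eq_inner, boundaryForm_eq_inner, real_inner_comm]

lemma dirichletForm_self_nonneg (w : Sobolev Ω) : 0 ≤ dirichletForm Ω w w :=
  real_inner_self_nonneg (x := grad w)

lemma boundaryForm_self_nonneg (w : Sobolev Ω) : 0 ≤ boundaryForm Ω w w :=
  real_inner_self_nonneg (x := trace w)

lemma norm_sq_sobolev (w : Sobolev Ω) :
    ‖w‖ ^ 2 = massForm Ω w w + (dirichletForm Ω w w + boundaryForm Ω w w) := by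
  rw [massForm_eq_inner, dirichletForm_eq_inner, boundaryForm_eq_inner, real_inner_self_eq_norm_sq,
    real_inner_self_eq_norm_sq, real_inner_self_eq_norm_sq]
  change ‖(toH1L Ω w).1‖ ^ 2 = _
  rw [WithLp.prod_norm_sq_eq_of_L2, WithLp.prod_norm_sq_eq_of_L2]
  rfl

lemma formM_eq (w v : Sobolev Ω) : formM (fun _ => 1) w v = massForm Ω w v := by
  rw [massForm_eq_inner, L2.inner_def]
  simp [formM, mul_comm]

lemma formA0_eq (w v : Sobolev Ω) : formA0 (fun _ => 1) w v = dirichletForm Ω w v := by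
  rw [dirichletForm_eq_inner, L2.inner_def]
  simp [formA0]

lemma formA1_eq (w v : Sobolev Ω) : formA1 w v = boundaryForm Ω w v := by
  rw [boundaryForm_eq_inner, L2.inner_def]
  simp [formA1, mul_comm]

lemma IsSmoothRep.massForm_eq {w v : Sobolev Ω} {f g : Plane → ℝ} (hw : IsSmoothRep w f)
    (hv : IsSmoothRep v g) : massForm Ω w v = ∫ x in Ω, f x * g x := by
  rw [massForm_eq_inner, L2.inner_def]
  refine integral_congr_ae ?_
  filter_upwards [hw.2.1, hv.2.1] with x h1 h2
  simp [h1, h2, mul_comm]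

lemma IsSmoothRep.dirichletForm_eq {w v : Sobolev Ω} {f g : Plane → ℝ} (hw : IsSmoothRep w f)
    (hv : IsSmoothRep v g) : dirichletForm Ω w v = ∫ x in Ω, inner ℝ (∇ f x) (∇ g x) := by
  rw [dirichletForm_eq_inner, L2.inner_def]
  refine integral_congr_ae ?_
  filter_upwards [hw.2.2.1, hv.2.2.1] with x h1 h2
  rw [h1, h2]

lemma IsSmoothRep.boundaryForm_eq {w v : Sobolev Ω} {f g : Plane → ℝ} (hw : IsSmoothRep w f)
    (hv : IsSmoothRep v g) : boundaryForm Ω w v = ∫ x, f x * g x ∂(boundaryMeasure Ω) := by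
  rw [boundaryForm_eq_inner, L2.inner_def]
  refine integral_congr_ae ?_
  filter_upwards [hw.2.2.2, hv.2.2.2] with x h1 h2
  simp [h1, h2, mul_comm]

lemma memLp_two_of_isBounded {E : Type*} [NormedAddCommGroup E] {μ : Measure Plane}
    [IsFiniteMeasure μ] {K : Set Plane} (hK : IsCompact K) (hμ : ∀ᵐ x ∂μ, x ∈ K) {f : Plane → E}
    (hf : Continuous f) : MemLp f 2 μ := by
  obtain ⟨C, hC⟩ := hK.exists_bound_of_continuousOn hf.continuousOn
  exact MemLp.of_bound hf.aestronglyMeasurable C (hμ.mono fun x hx => hC x hx)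

/-- A smooth function on the plane defines an element of `H¹(Ω)`. -/
lemma exists_isSmoothRep (hb : Bornology.IsBounded Ω) (hm : MeasurableSet Ω)
    [IsFiniteMeasure (boundaryMeasure Ω)]
    {f : Plane → ℝ} (hf : ContDiff ℝ ∞ f) : ∃ w : Sobolev Ω, IsSmoothRep w f := by
  have hcomp : IsCompact (closure Ω) :=
    Metric.isCompact_of_isClosed_isBounded isClosed_closure hb.closure
  have : IsFiniteMeasure (interiorMeasure Ω) := ⟨by simpa using hb.measure_lt_top⟩
  have a1 : ∀ᵐ x ∂(interiorMeasure Ω), x ∈ closure Ω :=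
    (ae_restrict_mem hm).mono fun x hx => subset_closure hx
  have a2 : ∀ᵐ x ∂(boundaryMeasure Ω), x ∈ closure Ω :=
    (ae_restrict_mem isClosed_frontier.measurableSet).mono fun x hx => frontier_subset_closure hx
  have m1 : MemLp f 2 (interiorMeasure Ω) := memLp_two_of_isBounded hcomp a1 hf.continuous
  have m2 : MemLp (∇ f) 2 (interiorMeasure Ω) :=
    memLp_two_of_isBounded hcomp a1 (continuous_gradient (hf.of_le (by simp)))
  have m3 : MemLp f 2 (boundaryMeasure Ω) := memLp_two_of_isBounded hcomp a2 hf.continuous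
  let t : Triple Ω := WithLp.toLp 2 (m1.toLp f, WithLp.toLp 2 (m2.toLp (∇ f), m3.toLp f))
  have ht : t ∈ smoothGraph Ω := ⟨f, hf, m1.coeFn_toLp, m2.coeFn_toLp, m3.coeFn_toLp⟩
  exact ⟨⟨t, smoothGraph_le_H1 ht⟩, hf, m1.coeFn_toLp, m2.coeFn_toLp, m3.coeFn_toLp⟩

end Sobolev

/-! ### From a spectral gap to a unique nonnegative first eigenfunction. -/

section FirstEigenfunction

variable {Ω : Set Plane}

lemma isRobinEigenpair_iff {B l : ℝ} {ψ : Sobolev Ω} :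
    IsRobinEigenpair (fun _ => 1) (fun _ => 1) Ω B ψ l ↔
      (∀ v, dirichletForm Ω ψ v + B * boundaryForm Ω ψ v = l * massForm Ω ψ v) ∧
        massForm Ω ψ ψ = 1 := by
  refine and_congr (forall_congr' fun v => ?_) (Iff.of_eq (congrArg (· = 1) (formM_eq ψ ψ)))
  exact Iff.of_eq (congrArg₂ (· = ·)
    (congrArg₂ (· + ·) (formA0_eq ψ v) (congrArg (B * ·) (formA1_eq ψ v)))
    (congrArg (l * ·) (formM_eq ψ v)))

lemma massForm_nonneg_of_nonneg {w v : Sobolev Ω} (hw : ∀ᵐ x ∂(interiorMeasure Ω), 0 ≤ val w x)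
    (hv : ∀ᵐ x ∂(interiorMeasure Ω), 0 ≤ val v x) : 0 ≤ massForm Ω w v := by
  rw [massForm_eq_inner, L2.inner_def]
  refine integral_nonneg_of_ae ?_
  filter_upwards [hw, hv] with x h1 h2
  simpa using mul_nonneg h2 h1

/-- A nonnegative normalized eigenfunction with a spectral gap is the first eigenfunction. -/
theorem isFirstEigenfunction_of_gap {B l c : ℝ} (hc : 0 < c) {ψ : Sobolev Ω}
    (he : ∀ v, dirichletForm Ω ψ v + B * boundaryForm Ω ψ v = l * massForm Ω ψ v)
    (hn : massForm Ω ψ ψ = 1)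
    (hgap : ∀ w, c * ‖w - massForm Ω ψ w • ψ‖ ^ 2 ≤
      dirichletForm Ω w w + B * boundaryForm Ω w w - l * massForm Ω w w)
    (hpos : ∀ᵐ x ∂(interiorMeasure Ω), 0 ≤ val ψ x) :
    IsFirstEigenfunction (fun _ => 1) (fun _ => 1) Ω B ψ ∧
      ∀ χ, IsFirstEigenfunction (fun _ => 1) (fun _ => 1) Ω B χ → χ = ψ := by
  have hpair : IsRobinEigenpair (fun _ => 1) (fun _ => 1) Ω B ψ l :=
    isRobinEigenpair_iff.2 ⟨he, hn⟩
  refine ⟨⟨⟨l, hpair, fun χ l' h => ?_⟩, hpos⟩, ?_⟩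
  · have h1 := isRobinEigenpair_iff.1 h
    exact (least_eigenvalue_of_gap hc hn hgap h1.1 h1.2).1
  · rintro χ ⟨⟨l', h1, h2⟩, h3⟩
    have h4 := isRobinEigenpair_iff.1 h1
    exact (least_eigenvalue_of_gap hc hn hgap h4.1 h4.2).2 (h2 ψ l hpair)
      (massForm_nonneg_of_nonneg hpos h3)

lemma gradient_sqrt_sq_add {f : Plane → ℝ} (hf : ContDiff ℝ ∞ f) {ε : ℝ} (hε : 0 < ε)
    (x : Plane) : ∇ (fun x => √(f x ^ 2 + ε ^ 2)) x =
      (f x / √(f x ^ 2 + ε ^ 2)) • ∇ f x := by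
  have hpos : 0 < f x ^ 2 + ε ^ 2 := by positivity
  have h1 := ((((hf.differentiable (by simp)) x).hasFDerivAt.pow 2).add_const (ε ^ 2)).sqrt hpos.ne'
  have h2 := h1.fderiv
  simp only [gradient]
  rw [h2, ← map_smul (InnerProductSpace.toDual ℝ Plane).symm, smul_smul]
  congr 2
  have : √(f x ^ 2 + ε ^ 2) ≠ 0 := (Real.sqrt_pos.2 hpos).ne'
  simp only [Nat.add_one_sub_one, pow_one, Nat.cast_ofNat, nsmul_eq_mul]
  field_simp

/-- A smooth substitute for `|w|`, which does not increase the Rayleigh quotient by much. -/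
lemma exists_smooth_abs (hb : Bornology.IsBounded Ω) (hm : MeasurableSet Ω)
    [IsFiniteMeasure (boundaryMeasure Ω)] [IsFiniteMeasure (interiorMeasure Ω)] {w : Sobolev Ω}
    {f : Plane → ℝ} (hw : IsSmoothRep w f) {ε : ℝ} (hε : 0 < ε) :
    ∃ z : Sobolev Ω, dirichletForm Ω z z ≤ dirichletForm Ω w w ∧ massForm Ω w w ≤ massForm Ω z z ∧
      boundaryForm Ω z z ≤ boundaryForm Ω w w + ε ^ 2 * (boundaryMeasure Ω).real univ ∧
      ‖val z - |val w|‖ ≤ measureUnivNNReal (interiorMeasure Ω) ^ (ENNReal.toReal 2)⁻¹ * ε := by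
  have hf := hw.1
  -- Unlike `|f|` this is smooth. Its gradient is that of `f` times a factor of modulus at most `1`,
  -- its square exceeds `f²` by exactly `ε²`, and it lies within `ε` of `|f|`.
  set g : Plane → ℝ := fun x => √(f x ^ 2 + ε ^ 2) with hg
  have hgc : ContDiff ℝ ∞ g :=
    ((hf.pow 2).add contDiff_const).sqrt fun x => by positivity
  obtain ⟨z, hz⟩ := exists_isSmoothRep hb hm hgc
  have hcomp : IsCompact (closure Ω) :=
    Metric.isCompact_of_isClosed_isBounded isClosed_closure hb.closure
  have hint : ∀ {k : Plane → ℝ}, Continuous k → Integrable k (interiorMeasure Ω) := fun hk =>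
    (hk.continuousOn.integrableOn_compact hcomp).mono_set subset_closure
  have hintb : ∀ {k : Plane → ℝ}, Continuous k → Integrable k (boundaryMeasure Ω) := fun hk =>
    (memLp_two_of_isBounded hcomp ((ae_restrict_mem isClosed_frontier.measurableSet).mono
      fun x hx => frontier_subset_closure hx) hk).integrable one_le_two
  have cf := hf.continuous
  have cg := hgc.continuous
  have cf' := continuous_gradient (hf.of_le (by simp) : ContDiff ℝ 1 f)
  have cg' := continuous_gradient (hgc.of_le (by simp) : ContDiff ℝ 1 g)
  have hsq : ∀ x, g x * g x = f x * f x + ε ^ 2 := fun x => by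
    simp only [hg]
    rw [Real.mul_self_sqrt (by positivity), sq (f x)]
  have hgpos : ∀ x, 0 < g x := fun x => Real.sqrt_pos.2 (by positivity)
  have habs : ∀ x, |f x| ≤ g x := fun x => by
    rw [← abs_of_pos (hgpos x)]
    exact sq_le_sq.1 (by nlinarith [hsq x, sq_nonneg ε])
  refine ⟨z, ?_, ?_, ?_, ?_⟩
  · refine (hz.dirichletForm_eq hz).trans_le (le_trans ?_ (hw.dirichletForm_eq hw).ge)
    refine integral_mono (hint (by fun_prop)) (hint (by fun_prop)) fun x => ?_
    simp only [real_inner_self_eq_norm_sq]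
    refine pow_le_pow_left₀ (norm_nonneg _) ?_ 2
    rw [hg, gradient_sqrt_sq_add hf hε, norm_smul, Real.norm_eq_abs, abs_div,
      abs_of_pos (hgpos x)]
    exact mul_le_of_le_one_left (norm_nonneg _) ((div_le_one (hgpos x)).2 (habs x))
  · refine (hw.massForm_eq hw).trans_le (le_trans ?_ (hz.massForm_eq hz).ge)
    refine integral_mono (hint (by fun_prop)) (hint (by fun_prop)) fun x => ?_
    simp only [hsq]
    linarith [sq_nonneg ε]
  · refine (hz.boundaryForm_eq hz).trans_le (le_trans ?_
      (add_le_add_left (hw.boundaryForm_eq hw).ge _))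
    simp only [hsq]
    rw [integral_add (hintb (by fun_prop)) (integrable_const _)]
    simp [mul_comm]
  · refine Lp.norm_le_of_ae_bound hε.le ?_
    filter_upwards [hz.2.1, hw.2.1, Lp.coeFn_sub (val z) |val w|, Lp.coeFn_abs (val w)] with
      x h1 h2 h3 h4
    rw [h3, Pi.sub_apply, h4, h1, h2, Real.norm_eq_abs, abs_of_nonneg (sub_nonneg.2 (habs x))]
    have : g x ≤ |f x| + ε := by
      refine abs_le_of_sq_le_sq' ?_ (by positivity) |>.2
      nlinarith [hsq x, sq_abs (f x), mul_nonneg (abs_nonneg (f x)) hε.le]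
    linarith

/-- An eigenfunction with a spectral gap that has positive mass against a nonnegative function is
nonnegative. -/
theorem nonneg_of_gap (hb : Bornology.IsBounded Ω) (hm : MeasurableSet Ω)
    [IsFiniteMeasure (boundaryMeasure Ω)] {B l c : ℝ} (hB : 0 ≤ B) (hc : 0 < c) {ψ ψ₀ : Sobolev Ω}
    (he : ∀ v, dirichletForm Ω ψ v + B * boundaryForm Ω ψ v = l * massForm Ω ψ v)
    (hn : massForm Ω ψ ψ = 1)
    (hgap : ∀ w, c * ‖w - massForm Ω ψ w • ψ‖ ^ 2 ≤
      dirichletForm Ω w w + B * boundaryForm Ω w w - l * massForm Ω w w)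
    (hψ₀ : ∀ᵐ x ∂(interiorMeasure Ω), 0 ≤ val ψ₀ x) (hpos : 0 < massForm Ω ψ₀ ψ) :
    ∀ᵐ x ∂(interiorMeasure Ω), 0 ≤ val ψ x := by
  have : IsFiniteMeasure (interiorMeasure Ω) := ⟨by simpa using hb.measure_lt_top⟩
  have hl : 0 ≤ l := by
    have := he ψ
    rw [hn, mul_one] at this
    rw [← this]
    exact add_nonneg (dirichletForm_self_nonneg _) (mul_nonneg hB (boundaryForm_self_nonneg _))
  obtain ⟨w, hwr, hw⟩ := mem_closure_iff_seq_limit.1 (dense_isSmoothRep ψ)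
  choose f hf using hwr
  set ε : ℕ → ℝ := fun n => 1 / ((n : ℝ) + 1) with hε
  have hεp : ∀ n, 0 < ε n := fun n => by positivity
  have hε0 : Tendsto ε atTop (𝓝 0) := tendsto_one_div_add_atTop_nhds_zero_nat
  choose z hz1 hz2 hz3 hz4 using fun n => exists_smooth_abs hb hm (hf n) (hεp n)
  have hsmall : Tendsto (fun n => z n - massForm Ω ψ (z n) • ψ) atTop (𝓝 0) := by
    refine tendsto_sub_smul_of_gap hB hl hc he hgap hw
      (δ := fun n => ε n ^ 2 * (boundaryMeasure Ω).real univ) ?_ hz1 hz2 hz3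
    simpa using (hε0.pow 2).mul_const ((boundaryMeasure Ω).real univ)
  have hval : Tendsto (fun n => val (z n)) atTop (𝓝 |val ψ|) := by
    have h1 : Tendsto (fun n => |val (w n)|) atTop (𝓝 |val ψ|) :=
      ((continuous_id.sup continuous_neg).tendsto (val ψ)).comp
        (((valL Ω).continuous.tendsto ψ).comp hw)
    have h2 : Tendsto (fun n => val (z n) - |val (w n)|) atTop (𝓝 0) := by
      refine squeeze_zero_norm hz4 ?_
      simpa using hε0.const_mul
        ((measureUnivNNReal (interiorMeasure Ω) : ℝ) ^ (ENNReal.toReal 2)⁻¹)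
    simpa using h2.add h1
  have hcoef : Tendsto (fun n => massForm Ω ψ (z n)) atTop (𝓝 (inner ℝ (val ψ) |val ψ|)) :=
    tendsto_const_nhds.inner hval
  set s : ℝ := inner ℝ (val ψ) |val ψ| with hs
  -- The `z n` approach `|ψ|` in `L²` and, by the gap, the line of `ψ`. Comparing the limits in `L²`
  -- suffices; `|ψ|` need not be placed in `H¹`.
  have hlim : |val ψ| - s • val ψ = 0 := by
    have h1 : Tendsto (fun n => val (z n) - massForm Ω ψ (z n) • val ψ) atTop
        (𝓝 (|val ψ| - s • val ψ)) := hval.sub (hcoef.smul_const _)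
    have h2 : Tendsto (fun n => valL Ω (z n - massForm Ω ψ (z n) • ψ)) atTop (𝓝 (valL Ω 0)) :=
      ((valL Ω).continuous.tendsto 0).comp hsmall
    rw [map_zero] at h2
    refine tendsto_nhds_unique h1 (h2.congr fun n => ?_)
    rw [map_sub, map_smul]
    rfl
  have habs : |val ψ| = s • val ψ := sub_eq_zero.1 hlim
  -- Pairing `|ψ| = s ψ` with `ψ₀ ≥ 0` gives `s M(ψ₀, ψ) ≥ 0`. With `s ≥ 0`, the relation cannot
  -- hold where `ψ < 0`.
  have hs0 : 0 ≤ s := by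
    have h1 : 0 ≤ (inner ℝ (val ψ₀) |val ψ| : ℝ) := by
      rw [L2.inner_def]
      refine integral_nonneg_of_ae ?_
      filter_upwards [hψ₀, Lp.coeFn_abs (val ψ)] with x h1 h2
      rw [h2]
      simpa using mul_nonneg (abs_nonneg (val ψ x)) h1
    rw [habs, real_inner_smul_right, ← massForm_eq_inner] at h1
    exact nonneg_of_mul_nonneg_left h1 hpos
  filter_upwards [Lp.coeFn_abs (val ψ), Lp.coeFn_smul s (val ψ)] with x h1 h2
  rw [habs, h2, Pi.smul_apply, smul_eq_mul] at h1
  by_contra hneg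
  push Not at hneg
  have h3 := abs_pos.2 hneg.ne
  nlinarith

end FirstEigenfunction

/-! ### The sensitivity derivative on a triangle. -/

section Triangle

variable {p q r : Plane}

lemma volume_triangle_pos (h : cross (q - p) (r - p) ≠ 0) :
    0 < volume.real (triangle p q r) :=
  ENNReal.toReal_pos ((isOpen_triangle p q r).measure_pos volume (triangle_nonempty h)).ne'
    (isBounded_triangle p q r).measure_lt_top.ne

/-- Statements that are closed conditions on `H¹` may be checked on smooth functions. -/
lemma forall_sobolev_of_smooth {Ω : Set Plane} {P : Sobolev Ω → Prop} (hP : IsClosed {w | P w})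
    (hs : ∀ w f, IsSmoothRep w f → P w) (w : Sobolev Ω) : P w :=
  closure_minimal (s := {w : Sobolev Ω | ∃ f, IsSmoothRep w f})
    (fun v hv => hv.elim fun f hf => hs v f hf) hP (dense_isSmoothRep w)

/-- Coercivity of the Dirichlet form, up to the constants, on the space of a triangle. -/
theorem exists_coercivity (h : cross (q - p) (r - p) ≠ 0) {ψ₀ : Sobolev (triangle p q r)} {a : ℝ}
    (hψ₀ : IsSmoothRep ψ₀ fun _ => a) (ha : a ^ 2 * volume.real (triangle p q r) = 1) :
    ∃ c : ℝ, 0 < c ∧ ∀ w, c * ‖w‖ ^ 2 ≤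
      dirichletForm (triangle p q r) w w + massForm (triangle p q r) ψ₀ w ^ 2 := by
  obtain ⟨C₁, hC₁, hp⟩ := exists_poincare_inequality (isOpen_triangle p q r)
    (convex_triangle p q r) (isBounded_triangle p q r)
  obtain ⟨C₂, hC₂, ht⟩ := exists_trace_inequality h
  set A := volume.real (triangle p q r) with hA
  have hA0 : 0 < A := volume_triangle_pos h
  -- The factor `1 + C₂` absorbs the boundary mass by the trace inequality; `1 + C₁ a²` absorbs the
  -- interior mass by Poincaré, multiplied by `a² = 1 / |T|`.
  refine ⟨((1 + C₂) * (1 + C₁ * a ^ 2))⁻¹, by positivity, ?_⟩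
  refine forall_sobolev_of_smooth (isClosed_le (by fun_prop) (by fun_prop)) fun w f hw => ?_
  have hf : ContDiff ℝ 1 f := hw.1.of_le (by simp)
  have e1 := hw.massForm_eq hw
  have e2 := hw.dirichletForm_eq hw
  have e3 := hw.boundaryForm_eq hw
  have e4 := hψ₀.massForm_eq hw
  have k1 := hp f hf
  have k2 := ht f hf
  simp only [real_inner_self_eq_norm_sq, ← sq] at e1 e2 e3
  rw [integral_const_mul] at e4
  rw [← e1, ← e2] at k2
  rw [← e3] at k2
  rw [← e1, ← e2] at k1
  set m := massForm (triangle p q r) w w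
  set d := dirichletForm (triangle p q r) w w
  set b := boundaryForm (triangle p q r) w w
  set s := massForm (triangle p q r) ψ₀ w
  have hd : 0 ≤ d := dirichletForm_self_nonneg w
  have k3 : m ≤ C₁ * a ^ 2 * d + s ^ 2 := by
    rw [e4]
    have := mul_le_mul_of_nonneg_left k1 (sq_nonneg a)
    have e5 : a ^ 2 * (A * m) = m := by rw [← mul_assoc, ha, one_mul]
    nlinarith
  rw [inv_mul_le_iff₀ (by positivity), norm_sq_sobolev]
  have k4 : m + d ≤ (1 + C₁ * a ^ 2) * (d + s ^ 2) := by
    nlinarith [mul_nonneg (mul_nonneg hC₁.le (sq_nonneg a)) (sq_nonneg s)]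
  calc m + (d + b) ≤ (1 + C₂) * (m + d) := by linarith
    _ ≤ (1 + C₂) * ((1 + C₁ * a ^ 2) * (d + s ^ 2)) := by gcongr
    _ = _ := by ring

lemma gradient_sq_dist (k : ℝ) (z x : Plane) :
    ∇ (fun x : Plane => k * ‖x - z‖ ^ 2) x = (2 * k) • (x - z) := by
  refine HasGradientAt.gradient ?_
  have h1 : HasFDerivAt (fun x : Plane => ‖x - z‖ ^ 2) (2 • (innerSL ℝ (x - z))) x := by
    have := ((hasFDerivAt_id (𝕜 := ℝ) x).sub_const z).norm_sq
    simpa using this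
  rw [hasGradientAt_iff_hasFDerivAt]
  refine (h1.const_mul k).congr_fderiv ?_
  ext v
  simp
  ring

/-- The derivative of the first eigenfunction, up to a constant, is a paraboloid centred at the
incenter. -/
lemma paraboloid_weak_equation (h : cross (q - p) (r - p) ≠ 0)
    {ψ₀ u : Sobolev (triangle p q r)} {a : ℝ} (hψ₀ : IsSmoothRep ψ₀ fun _ => a)
    (hu : IsSmoothRep u fun x => -(a / (2 * inradius p q r)) * ‖x - incenter p q r‖ ^ 2)
    (v : Sobolev (triangle p q r)) :
    dirichletForm (triangle p q r) u v + boundaryForm (triangle p q r) ψ₀ v =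
      2 / inradius p q r * massForm (triangle p q r) ψ₀ v := by
  revert v
  refine forall_sobolev_of_smooth (isClosed_eq (by fun_prop) (by fun_prop)) fun v f hv => ?_
  have hρ := inradius_pos h
  have hf : ContDiff ℝ 1 f := hv.1.of_le (by simp)
  have cf := hf.continuous
  have cg := continuous_gradient hf
  have key := integral_div_incenter h hf
  rw [integral_add (integrableOn_triangle p q r (by fun_prop))
    (integrableOn_triangle p q r (by fun_prop)), integral_const_mul] at key
  have e1 : dirichletForm (triangle p q r) u v =
      -(a / inradius p q r) *
        ∫ x in triangle p q r, inner ℝ (∇ f x) (x - incenter p q r) := by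
    refine (hu.dirichletForm_eq hv).trans ?_
    rw [← integral_const_mul]
    congr 1
    funext x
    rw [gradient_sq_dist, real_inner_smul_left, real_inner_comm]
    field_simp
  have e2 := hψ₀.boundaryForm_eq hv
  have e3 := hψ₀.massForm_eq hv
  rw [integral_const_mul] at e2 e3
  rw [e1, e2, e3]
  field_simp
  linear_combination (-a) * key

/-- The sensitivity derivative on a triangle. -/
theorem hasSensitivityDerivative_triangle (h : cross (q - p) (r - p) ≠ 0) :
    HasSensitivityDerivative (fun _ => 1) (fun _ => 1) (triangle p q r) ∧
    phi (fun _ => 1) (fun _ => 1) (triangle p q r) =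
      (volume.real (triangle p q r) * inradius p q r ^ 2)⁻¹ *
        ∫ x in triangle p q r, ‖x - incenter p q r‖ ^ 2 := by
  have := isFiniteMeasure_boundaryMeasure_triangle h
  have hb := isBounded_triangle p q r
  have hm := (isOpen_triangle p q r).measurableSet
  set T := triangle p q r with hT
  set A := volume.real T with hA
  have hA0 : 0 < A := volume_triangle_pos h
  have hρ := inradius_pos h
  set a := (√A)⁻¹ with ha
  have ha0 : 0 < a := by positivity
  have ha2 : a ^ 2 * A = 1 := by
    rw [ha, inv_pow, Real.sq_sqrt hA0.le, inv_mul_cancel₀ hA0.ne']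
  obtain ⟨ψ₀, hψ₀⟩ := exists_isSmoothRep hb hm (f := fun _ => a) contDiff_const
  obtain ⟨u, hu⟩ := exists_isSmoothRep hb hm
    (f := fun x => -(a / (2 * inradius p q r)) * ‖x - incenter p q r‖ ^ 2)
    (contDiff_const.mul ((contDiff_id.sub contDiff_const).norm_sq ℝ))
  obtain ⟨c, hc, hcoer⟩ := exists_coercivity h hψ₀ ha2
  have hM1 : massForm T ψ₀ ψ₀ = 1 := by
    rw [hψ₀.massForm_eq hψ₀]
    simp only [setIntegral_const, smul_eq_mul]
    rw [← ha2]; ring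
  have hD0 : dirichletForm T ψ₀ = 0 := by
    ext v
    have hg : grad ψ₀ = 0 := by
      refine Lp.ext ?_
      filter_upwards [hψ₀.2.2.1, Lp.coeFn_zero Plane 2 (interiorMeasure T)] with x h1 h2
      rw [h1, h2, gradient_fun_const]
      rfl
    rw [dirichletForm_eq_inner, hg, inner_zero_left]
    rfl
  obtain ⟨ψ, l, ψ', l', hψ, hl, hψ0, hl0, hev, hlin⟩ := exists_eigenpair_branch
    (A₁ := boundaryForm T) dirichletForm_comm massForm_comm hD0 hM1 hc hcoer
  have hgap := eventually_spectral_gap dirichletForm_comm boundaryForm_comm massForm_comm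
    boundaryForm_self_nonneg hc hcoer hψ.continuousAt hl hψ0 hl0 hev
  have hposev : ∀ᶠ B in 𝓝 (0 : ℝ), 0 < massForm T ψ₀ (ψ B) := by
    have hcont : ContinuousAt (fun B => massForm T ψ₀ (ψ B)) 0 :=
      (massForm T ψ₀).continuous.continuousAt.comp hψ.continuousAt
    refine continuousAt_const.eventually_lt hcont ?_
    rw [hψ0, hM1]; exact one_pos
  have hnn : ∀ᵐ x ∂(interiorMeasure T), 0 ≤ val ψ₀ x := by
    filter_upwards [hψ₀.2.1] with x hx
    rw [hx]; exact ha0.le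
  have hfirst : ∀ᶠ B in 𝓝[≥] (0 : ℝ),
      IsFirstEigenfunction (fun _ => 1) (fun _ => 1) T B (ψ B) ∧
      ∀ χ, IsFirstEigenfunction (fun _ => 1) (fun _ => 1) T B χ → χ = ψ B := by
    rw [eventually_nhdsWithin_iff]
    filter_upwards [hev, hgap, hposev] with B h1 h2 h3 hB
    exact isFirstEigenfunction_of_gap (half_pos hc) h1.1 h1.2 (h2 hB)
      (nonneg_of_gap hb hm hB (half_pos hc) h1.1 h1.2 (h2 hB) hnn h3)
  have huniq : ∀ᶠ B in 𝓝[≥] (0 : ℝ),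
      ∃! χ : H1 T, IsFirstEigenfunction (fun _ => 1) (fun _ => 1) T B χ := by
    filter_upwards [hfirst] with B hB
    exact ⟨ψ B, hB.1, hB.2⟩
  have heq : ∀ᶠ B in 𝓝[≥] (0 : ℝ),
      firstEigenfunction (fun _ => 1) (fun _ => 1) T B = toH1L T (ψ B) := by
    filter_upwards [hfirst, huniq] with B hB hu
    rw [firstEigenfunction, dif_pos hu]
    exact hB.2 _ hu.choose_spec.1
  have hder0 : HasDerivAt (fun B => toH1L T (ψ B)) (toH1L T ψ') 0 :=
    (toH1L T).hasFDerivAt.comp_hasDerivAt 0 hψ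
  have hder : HasDerivWithinAt (firstEigenfunction (fun _ => 1) (fun _ => 1) T) (toH1L T ψ')
      (Ici 0) 0 :=
    hder0.hasDerivWithinAt.congr_of_eventuallyEq heq (heq.self_of_nhdsWithin self_mem_Ici)
  refine ⟨⟨huniq, hder.differentiableWithinAt⟩, ?_⟩
  have hs : sensitivityDerivative (fun _ => 1) (fun _ => 1) T = toH1L T ψ' :=
    hder.derivWithin (uniqueDiffWithinAt_Ici 0)
  have hphi : phi (fun _ => 1) (fun _ => 1) T = dirichletForm T ψ' ψ' := by
    rw [phi, hs]
    exact formA0_eq ψ' ψ'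
  have hueq := paraboloid_weak_equation h hψ₀ hu
  have hD0' : ∀ w, dirichletForm T w ψ₀ = 0 := fun w => by
    rw [dirichletForm_comm, hD0]; rfl
  -- Testing both equations with the constant `ψ₀` removes the Dirichlet terms and leaves equal
  -- boundary terms.
  have hl' : l' = 2 / inradius p q r := by
    have h1 := hlin ψ₀
    have h2 := hueq ψ₀
    rw [hD0', hM1] at h1 h2
    linarith
  -- The derivative and the paraboloid agree in the Dirichlet form, hence have the same energy. The
  -- additive constant fixed by the normalization is not needed.
  have hsame : ∀ v, dirichletForm T ψ' v = dirichletForm T u v := fun v => by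
    have h1 := hlin v
    have h2 := hueq v
    rw [hl'] at h1
    linarith
  rw [hphi, hsame, dirichletForm_comm, hsame, hu.dirichletForm_eq hu]
  simp only [gradient_sq_dist, real_inner_self_eq_norm_sq, norm_smul, mul_pow]
  rw [integral_const_mul, Real.norm_eq_abs, sq_abs]
  congr 1
  have ha2' : a ^ 2 = A⁻¹ := eq_inv_of_mul_eq_one_left ha2
  have : (2 * -(a / (2 * inradius p q r))) ^ 2 = a ^ 2 / inradius p q r ^ 2 := by
    field_simp
  rw [this, ha2', mul_inv, div_eq_mul_inv]

end Triangle

/-! ### Evaluation for right and equilateral triangles. -/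

section Values

variable {p q r : Plane}

lemma integral_cubic (c₀ c₁ c₂ c₃ : ℝ) :
    ∫ x in (0 : ℝ)..1, (c₀ + c₁ * x + c₂ * x ^ 2 + c₃ * x ^ 3) =
      c₀ + c₁ / 2 + c₂ / 3 + c₃ / 4 := by
  rw [intervalIntegral.integral_eq_sub_of_hasDerivAt
    (f := fun x => c₀ * x + c₁ / 2 * x ^ 2 + c₂ / 3 * x ^ 3 + c₃ / 4 * x ^ 4)
    (fun x _ => ?_) (Continuous.intervalIntegrable (by fun_prop) _ _)]
  · simp
  · have h := ((((hasDerivAt_id x).const_mul c₀).add ((hasDerivAt_pow 2 x).const_mul (c₁ / 2))).add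
      ((hasDerivAt_pow 3 x).const_mul (c₂ / 3))).add ((hasDerivAt_pow 4 x).const_mul (c₃ / 4))
    refine h.congr_deriv ?_
    norm_num
    ring

lemma integral_quadratic_stdTriangle (α β γ i j : ℝ) :
    ∫ z in stdTriangle, (α * (z.1 - i) ^ 2 + 2 * β * ((z.1 - i) * (z.2 - j)) +
      γ * (z.2 - j) ^ 2) = α * (1 / 12 - i / 3 + i ^ 2 / 2) +
      2 * β * (1 / 24 - (i + j) / 6 + i * j / 2) + γ * (1 / 12 - j / 3 + j ^ 2 / 2) := by
  rw [setIntegral_stdTriangle_deriv_snd (G := fun z => α * (z.1 - i) ^ 2 * z.2 +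
    β * (z.1 - i) * (z.2 - j) ^ 2 + γ / 3 * (z.2 - j) ^ 3) (by fun_prop) (fun x y => ?_)]
  · rw [← sub_eq_zero]
    -- The coefficients come from expanding in powers of `x` the difference of the primitive at `y =
    -- 1 - x` and at `y = 0`.
    have := integral_cubic
      (α * i ^ 2 - β * (i * (1 - 2 * j)) + γ / 3 * (1 - 3 * j + 3 * j ^ 2))
      (α * (-2 * i - i ^ 2) + β * ((1 - 2 * j) + i * (2 - 2 * j)) +
        γ / 3 * (-3 + 6 * j - 3 * j ^ 2))
      (α * (1 + 2 * i) + β * ((-2 + 2 * j) - i) + γ / 3 * (3 - 3 * j))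
      (-α + β - γ / 3)
    rw [sub_eq_zero]
    calc _ = _ := by
          congr 1
          funext x
          simp only
          ring
      _ = _ := this
      _ = _ := by ring
  · have h1 := ((hasDerivAt_id y).sub_const j).pow 2
    have h2 := ((hasDerivAt_id y).sub_const j).pow 3
    have h := (((hasDerivAt_id y).const_mul (α * (x - i) ^ 2)).add
      (h1.const_mul (β * (x - i)))).add (h2.const_mul (γ / 3))
    refine h.congr_deriv ?_
    simp
    ring

lemma volume_real_triangle (h : cross (q - p) (r - p) ≠ 0) :
    volume.real (triangle p q r) = |cross (q - p) (r - p)| / 2 := by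
  have h1 := setIntegral_triangle h (fun _ => (1 : ℝ))
  have h2 := setIntegral_stdTriangle_deriv_snd (g := fun _ => 1) (G := fun z => z.2)
    continuous_const (fun x y => hasDerivAt_id y)
  have h3 := integral_cubic 1 (-1) 0 0
  have h4 : ∫ x in (0 : ℝ)..1, ((1 - x) - 0) = 1 / 2 := by
    rw [show (1 / 2 : ℝ) = 1 + -1 / 2 + 0 / 3 + 0 / 4 by norm_num, ← h3]
    congr 1
    funext x
    ring
  simp only at h2
  rw [h2, h4] at h1
  simp only [setIntegral_const, smul_eq_mul, mul_one] at h1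
  rw [h1]; ring

lemma cross_sq (a b : Plane) : cross a b ^ 2 = ‖a‖ ^ 2 * ‖b‖ ^ 2 - inner ℝ a b ^ 2 := by
  rw [EuclideanSpace.norm_sq_eq, EuclideanSpace.norm_sq_eq, PiLp.inner_apply]
  simp [Fin.sum_univ_two, cross]
  ring

/-- The sensitivity of a triangle in terms of its sides. -/
theorem phi_triangle (h : cross (q - p) (r - p) ≠ 0) :
    phi (fun _ => 1) (fun _ => 1) (triangle p q r) = 2 / inradius p q r ^ 2 *
      (‖q - p‖ ^ 2 * (1 / 12 - dist p r / perimeter p q r / 3 +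
          (dist p r / perimeter p q r) ^ 2 / 2) +
        2 * inner ℝ (q - p) (r - p) *
          (1 / 24 - (dist p r / perimeter p q r + dist p q / perimeter p q r) / 6 +
            dist p r / perimeter p q r * (dist p q / perimeter p q r) / 2) +
        ‖r - p‖ ^ 2 * (1 / 12 - dist p q / perimeter p q r / 3 +
          (dist p q / perimeter p q r) ^ 2 / 2)) := by
  rw [(hasSensitivityDerivative_triangle h).2, setIntegral_triangle h, volume_real_triangle h,
    ← integral_quadratic_stdTriangle]
  set i := dist p r / perimeter p q r with hi
  set j := dist p q / perimeter p q r with hj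
  have hnorm : ∀ z, ‖param p q r z - incenter p q r‖ ^ 2 =
      ‖q - p‖ ^ 2 * (z.1 - i) ^ 2 + 2 * inner ℝ (q - p) (r - p) * ((z.1 - i) * (z.2 - j)) +
        ‖r - p‖ ^ 2 * (z.2 - j) ^ 2 := by
    intro z
    have : param p q r z - incenter p q r = (z.1 - i) • (q - p) + (z.2 - j) • (r - p) := by
      simp only [incenter, param, ← hi, ← hj]
      module
    rw [this, norm_add_sq_real, norm_smul, norm_smul, mul_pow, mul_pow, real_inner_smul_left,
      real_inner_smul_right, Real.norm_eq_abs, Real.norm_eq_abs, sq_abs, sq_abs]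
    ring
  simp only [hnorm, smul_eq_mul]
  generalize ∫ z in stdTriangle, (‖q - p‖ ^ 2 * (z.1 - i) ^ 2 +
    2 * inner ℝ (q - p) (r - p) * ((z.1 - i) * (z.2 - j)) + ‖r - p‖ ^ 2 * (z.2 - j) ^ 2) = X
  have := abs_pos.2 h
  have := inradius_pos h
  field_simp

lemma cross_rightTriangle (W : ℝ) :
    cross (!₂[W, 0] - !₂[0, 0]) (!₂[0, 1] - !₂[0, 0]) = W := by
  simp [cross]

/-- The sensitivity of the right triangle with legs `W` and `1`. -/
lemma phi_rightTriangle {W : ℝ} (hW : 0 < W) :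
    phi (fun _ => 1) (fun _ => 1) (rightTriangle W) =
      ((W ^ 2 + 1) * (W + √(W ^ 2 + 1) + 1) ^ 2 / 6 -
        2 / 3 * W * (W + 1) * (W + √(W ^ 2 + 1) + 1) + 2 * W ^ 2) * W ^ (-2 : ℤ) := by
  have h : cross (!₂[W, 0] - !₂[0, 0]) (!₂[0, 1] - !₂[0, 0]) ≠ 0 := by
    rw [cross_rightTriangle]; exact hW.ne'
  have d1 : dist (!₂[0, 0] : Plane) !₂[W, 0] = W := by
    rw [EuclideanSpace.dist_eq]
    simp [Fin.sum_univ_two, Real.dist_eq, Real.sqrt_sq hW.le]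
  have d2 : dist (!₂[W, 0] : Plane) !₂[0, 1] = √(W ^ 2 + 1) := by
    rw [EuclideanSpace.dist_eq]
    simp [Fin.sum_univ_two, Real.dist_eq]
  have d3 : dist (!₂[0, 0] : Plane) !₂[0, 1] = 1 := by
    rw [EuclideanSpace.dist_eq]
    simp [Fin.sum_univ_two, Real.dist_eq]
  have n1 : ‖(!₂[W, 0] - !₂[0, 0] : Plane)‖ = W := by rw [← dist_eq_norm, dist_comm, d1]
  have n2 : ‖(!₂[0, 1] - !₂[0, 0] : Plane)‖ = 1 := by rw [← dist_eq_norm, dist_comm, d3]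
  have n3 : inner ℝ (!₂[W, 0] - !₂[0, 0] : Plane) (!₂[0, 1] - !₂[0, 0]) = 0 := by
    simp [PiLp.inner_apply, Fin.sum_univ_two]
  rw [rightTriangle, phi_triangle h, inradius, perimeter, cross_rightTriangle, d1, d2, d3, n1, n2,
    n3, abs_of_pos hW]
  have hc : 0 ≤ √(W ^ 2 + 1) := Real.sqrt_nonneg _
  have hP : 0 < W + √(W ^ 2 + 1) + 1 := by positivity
  generalize √(W ^ 2 + 1) = c at *
  rw [zpow_neg]
  norm_cast
  field_simp
  ring

lemma isEquivalent_phi_rightTriangle :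
    (fun W : ℝ => phi (fun _ => 1) (fun _ => 1) (rightTriangle W)) ~[𝓝[>] (0 : ℝ)]
      (fun W : ℝ => 2 / 3 * W ^ (-2 : ℤ)) := by
  -- The factor in front of `W⁻²` is continuous at `0`, so the asymptotics reduce to its value
  -- there.
  set N : ℝ → ℝ := fun W => (W ^ 2 + 1) * (W + √(W ^ 2 + 1) + 1) ^ 2 / 6 -
        2 / 3 * W * (W + 1) * (W + √(W ^ 2 + 1) + 1) + 2 * W ^ 2 with hN
  have hNc : Continuous N := by fun_prop
  have hN0 : N 0 = 2 / 3 := by simp [hN]; norm_num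
  have h1 : N ~[𝓝[>] (0 : ℝ)] fun _ => (2 / 3 : ℝ) := by
    refine (isEquivalent_const_iff_tendsto (by norm_num : (2 / 3 : ℝ) ≠ 0)).2 ?_
    exact hN0 ▸ (hNc.tendsto 0).mono_left nhdsWithin_le_nhds
  have h2 := h1.mul (IsEquivalent.refl (u := fun W : ℝ => W ^ (-2 : ℤ)))
  refine h2.congr_left ?_
  filter_upwards [self_mem_nhdsWithin] with W hW
  exact (phi_rightTriangle hW).symm

lemma phi_rightTriangle_one : phi (fun _ => 1) (fun _ => 1) (rightTriangle 1) = 4 / 3 := by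
  rw [phi_rightTriangle one_pos]
  have h : √(2 : ℝ) ^ 2 = 2 := Real.sq_sqrt (by norm_num)
  rw [show (1 : ℝ) ^ 2 + 1 = 2 by norm_num, one_zpow]
  linear_combination (1 / 3) * h

lemma cross_ne_zero_of_equilateral (hpq : p ≠ q) (h1 : dist p q = dist q r)
    (h2 : dist q r = dist r p) :
    cross (q - p) (r - p) ^ 2 = 3 / 4 * dist p q ^ 4 ∧ inner ℝ (q - p) (r - p) = dist p q ^ 2 / 2 ∧
      cross (q - p) (r - p) ≠ 0 := by
  have n1 : ‖q - p‖ = dist p q := by rw [← dist_eq_norm, dist_comm]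
  have n2 : ‖r - p‖ = dist p q := by rw [← dist_eq_norm, ← h2, h1]
  have n3 : ‖(q - p) - (r - p)‖ = dist p q := by
    rw [sub_sub_sub_cancel_right, ← dist_eq_norm, h1]
  have hin : inner ℝ (q - p) (r - p) = dist p q ^ 2 / 2 := by
    have := norm_sub_sq_real (q - p) (r - p)
    rw [n1, n2, n3] at this
    linarith
  have hcr : cross (q - p) (r - p) ^ 2 = 3 / 4 * dist p q ^ 4 := by
    rw [cross_sq, n1, n2, hin]; ring
  refine ⟨hcr, hin, fun h0 => ?_⟩
  have := dist_pos.2 hpq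
  rw [h0] at hcr
  have : 0 < 3 / 4 * dist p q ^ 4 := by positivity
  linarith

lemma phi_equilateral (hpq : p ≠ q) (h1 : dist p q = dist q r) (h2 : dist q r = dist r p) :
    phi (fun _ => 1) (fun _ => 1) (triangle p q r) = 1 := by
  obtain ⟨hcr, hin, h⟩ := cross_ne_zero_of_equilateral hpq h1 h2
  have n1 : ‖q - p‖ = dist p q := by rw [← dist_eq_norm, dist_comm]
  have n2 : ‖r - p‖ = dist p q := by rw [← dist_eq_norm, ← h2, h1]
  have n4 : dist p r = dist p q := by rw [dist_comm p r, ← h2, h1]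
  have hs := dist_pos.2 hpq
  rw [phi_triangle h, inradius, div_pow, sq_abs, hcr, hin, n1, n2, perimeter, n4, ← h1]
  field_simp
  ring

end Values

end Dunking

end

theorem proposition6 :
    (∀ W : ℝ, 0 < W →
      Dunking.HasSensitivityDerivative (fun _ => 1) (fun _ => 1) (Dunking.rightTriangle W)) ∧
    (fun W : ℝ => Dunking.phi (fun _ => 1) (fun _ => 1) (Dunking.rightTriangle W))
      ~[𝓝[>] (0 : ℝ)] (fun W : ℝ => 2 / 3 * W ^ (-2 : ℤ)) ∧
    Dunking.phi (fun _ => 1) (fun _ => 1) (Dunking.rightTriangle 1) = 4 / 3 ∧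
    (∀ p q r : Dunking.Plane, p ≠ q → dist p q = dist q r → dist q r = dist r p →
      Dunking.HasSensitivityDerivative (fun _ => 1) (fun _ => 1) (Dunking.triangle p q r) ∧
      Dunking.phi (fun _ => 1) (fun _ => 1) (Dunking.triangle p q r) = 1) := by
  refine ⟨fun W hW => ?_, Dunking.isEquivalent_phi_rightTriangle, Dunking.phi_rightTriangle_one,
    fun p q r hpq h1 h2 => ⟨?_, Dunking.phi_equilateral hpq h1 h2⟩⟩
  · refine (Dunking.hasSensitivityDerivative_triangle ?_).1
    rw [Dunking.cross_rightTriangle]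
    exact hW.ne'
  · exact (Dunking.hasSensitivityDerivative_triangle
      (Dunking.cross_ne_zero_of_equilateral hpq h1 h2).2.2).1
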